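/- Let $N\ge 2$. A convex body in $\mathbb{R}^N$ is a compact convex set with non-empty interior; for a convex body $E$, let $\nu_E\colon\partial E\to\mathbb{S}^{N-1}$ be its inner unit normal, which is defined $\mathscr{H}^{N-1}$-a.e. on $\partial E$. Let $f\colon\mathbb{R}^N\times\mathbb{R}^N\to[0,+\infty]$ be a Borel function with $f\in L^1_{\rm loc}(\mathbb{R}^{2N})$. Assume that there exist a radial Borel function $g\colon\mathbb{R}^N\to[0,+\infty]$ and a lower semicontinuous, positively $1$-homogeneous (i.e. $\Phi(tv)=t\,\Phi(v)$ for all $t>0$ and $v\in\mathbb{R}^N$) and convex function $\Phi\colon\mathbb{R}^N\to[0,+\infty]$ with $\Phi(v)>0$ for all $v\neq 0$, such that $$f(x,v)=g(x)\,\Phi(v)\qquad\text{for all }x,v\in\mathbb{R}^N,$$ where $0\cdot(+\infty)=0$. If the anisotropic weighted perimeter $$P_f(E)=\int_{\partial E}f\big(x,\nu_E(x)\big)\,\mathrm{d}\mathscr{H}^{N-1}(x)$$ satisfies $P_f(A)\le P_f(B)$ for any two convex bodies $A\subset B$ in $\mathbb{R}^N$, then there is a constant $c\in[0,+\infty)$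 such that $g=c$ almost everywhere in $\mathbb{R}^N$ with respect to the Lebesgue measure. -/

import Mathlib

open MeasureTheory Set
open scoped ENNReal NNReal

noncomputable section

namespace WeightedPerimeter

/-- A convex body: a compact convex set with non-empty interior. -/
structure IsConvexBody {N : ℕ} (A : Set (EuclideanSpace ℝ (Fin N))) : Prop where
  isCompact : IsCompact A
  convex : Convex ℝ A
  interior_nonempty : (interior A).Nonempty

/-- `ν` is an inner unit normal of the convex set `A` at `x`: a unit vector such that `A` lies in
the half-space through `x` into which `ν` points. -/
def IsInnerUnitNormal {N : ℕ} (A : Set (EuclideanSpace ℝ (Fin N)))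
    (x ν : EuclideanSpace ℝ (Fin N)) : Prop :=
  ‖ν‖ = 1 ∧ ∀ y ∈ A, 0 ≤ inner ℝ (y - x) ν

open Classical in
/-- The inner unit normal `ν_A(x)` of a convex body `A` at a boundary point `x`. It is the only
inner unit normal at `x` wherever there is exactly one, hence almost everywhere on the boundary for
the `(N-1)`-dimensional Hausdorff measure; at the other points the value is irrelevant and is
set to `0`. -/
def innerUnitNormal {N : ℕ} (A : Set (EuclideanSpace ℝ (Fin N)))
    (x : EuclideanSpace ℝ (Fin N)) : EuclideanSpace ℝ (Fin N) :=
  if h : ∃! ν, IsInnerUnitNormal A x ν then h.choose else 0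

/-- The anisotropic weighted perimeter `∫_{∂A} f(x, ν_A(x)) dH^{N-1}(x)`; `μHE[N - 1]` is the
Hausdorff measure with the Euclidean normalization. -/
def anisotropicPerimeter {N : ℕ} (f : EuclideanSpace ℝ (Fin N) × EuclideanSpace ℝ (Fin N) → ℝ≥0∞)
    (A : Set (EuclideanSpace ℝ (Fin N))) : ℝ≥0∞ :=
  ∫⁻ x in frontier A, f (x, innerUnitNormal A x) ∂μHE[N - 1]

/-- The functional `P` is monotone on nested convex bodies. -/
def MonotoneOnConvexBodies {N : ℕ} (P : Set (EuclideanSpace ℝ (Fin N)) → ℝ≥0∞) : Prop :=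
  ∀ A B : Set (EuclideanSpace ℝ (Fin N)), IsConvexBody A → IsConvexBody B → A ⊆ B → P A ≤ P B

/-- A radial function: its value at a point depends only on the norm of the point. -/
def IsRadial {N : ℕ} (g : EuclideanSpace ℝ (Fin N) → ℝ≥0∞) : Prop :=
  ∀ x y, ‖x‖ = ‖y‖ → g x = g y

/-- Positive `1`-homogeneity, `Φ (t v) = t Φ v` for all `t > 0`. -/
def IsOneHomogeneous {N : ℕ} (Φ : EuclideanSpace ℝ (Fin N) → ℝ≥0∞) : Prop :=
  ∀ (t : ℝ≥0) (v : EuclideanSpace ℝ (Fin N)), 0 < t → Φ ((t : ℝ) • v) = (t : ℝ≥0∞) * Φ v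

end WeightedPerimeter

end

/-!
Compare the convex body between the graphs of `-u` and `0` over a disc of radius `δ` in a
hyperplane, where `u(z) = (δ² - |z|²) / 2`, with the larger body between the graphs of `-u` and
`η u`. Their bottoms contribute equally to the perimeter, so monotonicity compares the top graphs,
up to an area factor `1 + O(η²)`. Averaging this comparison over translations replaces `g` by a
mollification `G`. Differentiating at `η = 0`, integrating by parts and using Euler's identity for
the homogeneous function `Φ` gives `∫ L(∇G) u ≤ 0`, where `L` is the derivative of `Φ` at the inner
unit normal of the flat top. Letting `δ → 0` gives `L(∇G) ≤ 0` at every point and for every such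
`L`. If `∇G ≠ 0`, then `Φ(∇G) > 0`, and Euler's identity at points of differentiability near `∇G`
yields an `L` with `L(∇G) > 0`. Hence all mollifications of `g` are constant, and so is `g`.
-/

open Filter Topology

namespace WeightedPerimeter

section LocallyIntegrable

variable {X Y : Type*} [TopologicalSpace X] [MeasurableSpace X] [TopologicalSpace Y]
  [MeasurableSpace Y] {μ : Measure X} {ν : Measure Y} {g : X → ℝ≥0∞} {Φ : Y → ℝ≥0∞}

theorem ae_ne_top_of_locallyIntegrable [SecondCountableTopology X] (hg : LocallyIntegrable g μ) :
    ∀ᵐ x ∂μ, g x ≠ ∞ := by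
  obtain ⟨U, -, hU, hgU⟩ := hg.exists_nat_integrableOn
  rw [← Measure.restrict_univ (μ := μ), ← hU, ae_restrict_iUnion_iff]
  intro k
  filter_upwards [ae_lt_top' (hgU k).1.aemeasurable (hgU k).2.ne] with x hx using hx.ne

theorem locallyIntegrable_toReal (hg : LocallyIntegrable g μ) :
    LocallyIntegrable (fun x => (g x).toReal) μ := fun x =>
  let ⟨U, hU, hgU⟩ := hg x
  ⟨U, hU, integrable_toReal_of_lintegral_ne_top hgU.1.aemeasurable hgU.2.ne⟩

theorem ae_ne_top_right_of_locallyIntegrable_mul [SecondCountableTopology X]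
    [SecondCountableTopology Y] [SFinite ν]
    (h : LocallyIntegrable (fun q : X × Y => g q.1 * Φ q.2) (μ.prod ν)) (hg : ¬ g =ᵐ[μ] 0) :
    ∀ᵐ y ∂ν, Φ y ≠ ∞ := by
  have h_fin := Measure.ae_ae_of_ae_prod (ae_ne_top_of_locallyIntegrable h)
  obtain ⟨x, hx, hgx⟩ := (Filter.not_eventually.1 hg |>.and_eventually h_fin).exists
  filter_upwards [hgx] with y hy hΦy
  exact hy (by rw [hΦy, ENNReal.mul_top hx])

theorem locallyIntegrable_left_of_locallyIntegrable_mul [SFinite μ] [SFinite ν]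
    [ν.IsOpenPosMeasure] [Nonempty Y] (hg : AEMeasurable g μ) (hΦ : ∀ᵐ y ∂ν, Φ y ≠ 0)
    (h : LocallyIntegrable (fun q : X × Y => g q.1 * Φ q.2) (μ.prod ν)) :
    LocallyIntegrable g μ := by
  intro x
  obtain ⟨W, hW, hfW⟩ := h (x, Classical.arbitrary Y)
  obtain ⟨U, hU, V, hV, hUV⟩ := mem_nhds_prod_iff.1 hW
  have h_prod : Integrable (fun q : X × Y => g q.1 * Φ q.2) ((μ.restrict U).prod (ν.restrict V)) :=
    (Measure.prod_restrict (μ := μ) (ν := ν) U V).symm ▸ hfW.mono_set hUV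
  have h_fubini : ∀ᵐ y ∂ν.restrict V, ∫⁻ x in U, g x * Φ y ∂μ ≠ ∞ := by
    have h_ne_top := h_prod.2.ne
    simp only [enorm_eq_self] at h_ne_top
    rw [lintegral_prod_symm _ h_prod.1.aemeasurable] at h_ne_top
    exact (ae_lt_top' h_prod.1.aemeasurable.lintegral_prod_left' h_ne_top).mono fun _ => LT.lt.ne
  have : (ae (ν.restrict V)).NeBot :=
    ae_neBot.2 fun h0 => (Measure.measure_pos_of_mem_nhds ν hV).ne' (Measure.restrict_eq_zero.1 h0)
  obtain ⟨y, hy, hΦy⟩ := (h_fubini.and (ae_restrict_of_ae hΦ)).exists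
  rw [lintegral_mul_const'' _ hg.restrict] at hy
  refine ⟨U, hU, hg.restrict.aestronglyMeasurable, lt_top_iff_ne_top.2 fun h_top => hy ?_⟩
  simp only [enorm_eq_self] at h_top
  rw [h_top, ENNReal.top_mul hΦy]

end LocallyIntegrable

theorem ne_top_of_convexOn_of_ae_ne_top {E : Type*} [NormedAddCommGroup E] [NormedSpace ℝ E]
    [FiniteDimensional ℝ E] [MeasurableSpace E] [BorelSpace E] {μ : Measure E} [μ.IsAddHaarMeasure]
    {Φ : E → ℝ≥0∞} (hconv : ConvexOn ℝ≥0 univ Φ) (h : ∀ᵐ v ∂μ, Φ v ≠ ∞) (v : E) : Φ v ≠ ∞ := by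
  have h_add : ∀ᵐ u ∂μ, Φ (v + u) ≠ ∞ :=
    (measurePreserving_add_left μ v).quasiMeasurePreserving.ae h
  have h_sub : ∀ᵐ u ∂μ, Φ (v - u) ≠ ∞ :=
    (quasiMeasurePreserving_sub_left μ v).ae h
  obtain ⟨u, hu_add, hu_sub⟩ := (h_add.and h_sub).exists
  have h_half : (2⁻¹ : ℝ≥0) + 2⁻¹ = 1 := by rw [← two_mul, mul_inv_cancel₀ two_ne_zero]
  have h_mid : (2⁻¹ : ℝ≥0) • (v + u) + (2⁻¹ : ℝ≥0) • (v - u) = v := by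
    rw [← smul_add, add_add_sub_cancel, smul_add, ← add_smul, h_half, one_smul]
  have h_le := hconv.2 (mem_univ (v + u)) (mem_univ (v - u)) zero_le zero_le h_half
  rw [h_mid, ENNReal.smul_def, ENNReal.smul_def, smul_eq_mul, smul_eq_mul] at h_le
  exact ne_top_of_le_ne_top (by finiteness) h_le

/-- A sublinear function: subadditive and positively homogeneous of degree one. -/
structure IsSublinear {E : Type*} [AddCommMonoid E] [Module ℝ E] (Ψ : E → ℝ) : Prop where
  map_smul : ∀ t : ℝ, 0 < t → ∀ v, Ψ (t • v) = t * Ψ v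
  map_add_le : ∀ v w, Ψ (v + w) ≤ Ψ v + Ψ w

namespace IsSublinear

variable {E : Type*} [NormedAddCommGroup E] [NormedSpace ℝ E] {Ψ : E → ℝ}

theorem map_zero (h : IsSublinear Ψ) : Ψ 0 = 0 := by
  have := h.map_smul 2 two_pos 0
  rw [smul_zero] at this
  linarith

theorem convexOn (h : IsSublinear Ψ) : ConvexOn ℝ univ Ψ := by
  refine convexOn_iff_forall_pos.2 ⟨convex_univ, fun x _ y _ a b ha hb _ => ?_⟩
  rw [smul_eq_mul, smul_eq_mul, ← h.map_smul a ha, ← h.map_smul b hb]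
  exact h.map_add_le _ _

theorem map_le_add_map_sub (h : IsSublinear Ψ) (v w : E) : Ψ v ≤ Ψ w + Ψ (v - w) := by
  simpa using h.map_add_le w (v - w)

theorem lipschitzWith (h : IsSublinear Ψ) {M : ℝ≥0} (hM : ∀ v, Ψ v ≤ M * ‖v‖) :
    LipschitzWith M Ψ :=
  .of_le_add_mul M fun x y => by
    grw [h.map_le_add_map_sub x y, hM (x - y), dist_eq_norm]

theorem fderiv_apply_self (h : IsSublinear Ψ) {v : E} {L : E →L[ℝ] ℝ}
    (hL : HasFDerivAt Ψ L v) : L v = Ψ v := by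
  have h_line : HasDerivAt (fun t : ℝ => t • v) v 1 := by
    simpa using (hasDerivAt_id (1 : ℝ)).smul_const v
  have h_chain : HasDerivAt (fun t : ℝ => Ψ (t • v)) (L v) 1 :=
    HasFDerivAt.comp_hasDerivAt 1 (by rwa [one_smul]) h_line
  have h_hom : HasDerivAt (fun t : ℝ => Ψ (t • v)) (Ψ v) 1 := by
    have h_mul : HasDerivAt (fun t : ℝ => t * Ψ v) (Ψ v) 1 := by
      simpa using (hasDerivAt_id (1 : ℝ)).mul_const (Ψ v)
    refine h_mul.congr_of_eventuallyEq ?_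
    filter_upwards [lt_mem_nhds zero_lt_one] with t ht using h.map_smul t ht v
  exact h_chain.unique h_hom

theorem hasFDerivAt_smul (h : IsSublinear Ψ) {v : E} {L : E →L[ℝ] ℝ} (hL : HasFDerivAt Ψ L v)
    {t : ℝ} (ht : 0 < t) : HasFDerivAt Ψ L (t • v) := by
  have h_scale : HasFDerivAt (fun x : E => t⁻¹ • x) (t⁻¹ • ContinuousLinearMap.id ℝ E) (t • v) :=
    (hasFDerivAt_id _).const_smul t⁻¹
  have hL' : HasFDerivAt Ψ L (t⁻¹ • t • v) := by rwa [inv_smul_smul₀ ht.ne']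
  refine (((hL'.comp _ h_scale).const_smul t).congr_of_eventuallyEq
    (Eventually.of_forall fun x => ?_)).congr_fderiv ?_
  · rw [Pi.smul_apply, Function.comp_apply, smul_eq_mul, ← h.map_smul t ht,
      smul_inv_smul₀ ht.ne']
  · ext x
    simp [ht.ne']

variable [FiniteDimensional ℝ E]

theorem exists_le_mul_norm (h : IsSublinear Ψ) : ∃ M : ℝ≥0, ∀ v, Ψ v ≤ M * ‖v‖ := by
  have h_cont : Continuous Ψ := continuousOn_univ.1 (h.convexOn.continuousOn isOpen_univ)
  obtain ⟨M, hM⟩ := (isCompact_sphere (0 : E) 1).bddAbove_image h_cont.continuousOn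
  refine ⟨M.toNNReal, fun v => ?_⟩
  rcases eq_or_ne v 0 with rfl | hv
  · simp [h.map_zero]
  have hv_pos : 0 < ‖v‖ := norm_pos_iff.2 hv
  have h_unit : Ψ (‖v‖⁻¹ • v) ≤ M := hM ⟨_, by simp [norm_smul, hv], rfl⟩
  rw [h.map_smul _ (inv_pos.2 hv_pos), inv_mul_le_iff₀' hv_pos] at h_unit
  grw [h_unit, ← Real.le_coe_toNNReal M]

theorem continuous (h : IsSublinear Ψ) : Continuous Ψ :=
  let ⟨_, hM⟩ := h.exists_le_mul_norm
  (h.lipschitzWith hM).continuous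

theorem exists_hasFDerivAt_apply_pos (h : IsSublinear Ψ) {a : E} (ha : 0 < Ψ a) :
    ∃ (m : E) (L : E →L[ℝ] ℝ), ‖m‖ = 1 ∧ HasFDerivAt Ψ L m ∧ 0 < L a := by
  borelize E
  obtain ⟨M, hM⟩ := h.exists_le_mul_norm
  have h_lip := h.lipschitzWith hM
  have h_open : IsOpen {v | v ≠ 0 ∧ M * ‖a - v‖ < Ψ v} :=
    isOpen_ne.inter (isOpen_lt (by fun_prop) h.continuous)
  have ha_ne : a ≠ 0 := by
    rintro rfl
    exact ha.ne' h.map_zero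
  obtain ⟨v, ⟨hv_ne, hv⟩, hv_diff⟩ :=
    (Measure.dense_of_ae (h_lip.ae_differentiableAt (μ := Measure.addHaar))).inter_open_nonempty _
      h_open ⟨a, ha_ne, by simpa using ha⟩
  have hv_pos : 0 < ‖v‖ := norm_pos_iff.2 hv_ne
  refine ⟨‖v‖⁻¹ • v, fderiv ℝ Ψ v, by simp [norm_smul, hv_ne],
    h.hasFDerivAt_smul hv_diff.hasFDerivAt (inv_pos.2 hv_pos), ?_⟩
  have h_split : fderiv ℝ Ψ v a = Ψ v + fderiv ℝ Ψ v (a - v) := by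
    rw [← h.fderiv_apply_self hv_diff.hasFDerivAt, ← _root_.map_add, add_sub_cancel]
  have h_bound : ‖fderiv ℝ Ψ v (a - v)‖ ≤ M * ‖a - v‖ :=
    (fderiv ℝ Ψ v).le_of_opNorm_le (norm_fderiv_le_of_lipschitz ℝ h_lip) _
  linarith [neg_le_of_abs_le h_bound]

end IsSublinear

theorem isSublinear_toReal {N : ℕ} {Φ : EuclideanSpace ℝ (Fin N) → ℝ≥0∞}
    (h_hom : IsOneHomogeneous Φ) (h_conv : ConvexOn ℝ≥0 univ Φ) (h_fin : ∀ v, Φ v ≠ ∞) :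
    IsSublinear fun v => (Φ v).toReal where
  map_smul t ht v := by
    lift t to ℝ≥0 using ht.le
    rw [h_hom t v ht, ENNReal.toReal_mul, ENNReal.coe_toReal]
  map_add_le v w := by
    have h_half : (2⁻¹ : ℝ≥0) + 2⁻¹ = 1 := by rw [← two_mul, mul_inv_cancel₀ two_ne_zero]
    have h_mid (z : EuclideanSpace ℝ (Fin N)) : (2⁻¹ : ℝ≥0) • Φ ((2 : ℝ≥0) • z) = Φ z := by
      rw [NNReal.smul_def, h_hom 2 z two_pos, ENNReal.smul_def, smul_eq_mul, ← mul_assoc,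
        ← ENNReal.coe_mul, inv_mul_cancel₀ two_ne_zero, ENNReal.coe_one, one_mul]
    have h_le := h_conv.2 (mem_univ ((2 : ℝ≥0) • v)) (mem_univ ((2 : ℝ≥0) • w)) zero_le zero_le
      h_half
    rw [inv_smul_smul₀ two_ne_zero, inv_smul_smul₀ two_ne_zero, h_mid, h_mid] at h_le
    rw [← ENNReal.toReal_add (h_fin v) (h_fin w)]
    exact ENNReal.toReal_mono (by finiteness [h_fin v, h_fin w]) h_le

section Cap

/-- The paraboloid `(δ² - ‖z‖²) / 2`, which is positive exactly on the ball of radius `δ`. -/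
noncomputable def cap {V : Type*} [NormedAddCommGroup V] (δ : ℝ) (z : V) : ℝ :=
  (δ ^ 2 - ‖z‖ ^ 2) / 2

variable {V : Type*} [NormedAddCommGroup V] {δ : ℝ}

@[fun_prop]
theorem continuous_cap : Continuous (cap δ : V → ℝ) := by
  unfold cap
  fun_prop

theorem cap_nonneg_iff (hδ : 0 ≤ δ) {z : V} : 0 ≤ cap δ z ↔ z ∈ Metric.closedBall 0 δ := by
  rw [mem_closedBall_zero_iff, ← sq_le_sq₀ (norm_nonneg z) hδ, cap]
  constructor <;> intro h <;> linarith

theorem cap_pos_iff (hδ : 0 ≤ δ) {z : V} : 0 < cap δ z ↔ z ∈ Metric.ball 0 δ := by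
  rw [mem_ball_zero_iff, ← sq_lt_sq₀ (norm_nonneg z) hδ, cap]
  constructor <;> intro h <;> linarith

theorem cap_le (z : V) : cap δ z ≤ δ ^ 2 / 2 := by
  unfold cap
  linarith [sq_nonneg ‖z‖]

theorem abs_cap_sub_cap_le (hδ : 0 ≤ δ) {z w : V} (hz : z ∈ Metric.closedBall 0 δ)
    (hw : w ∈ Metric.closedBall 0 δ) : |cap δ z - cap δ w| ≤ δ * ‖z - w‖ := by
  rw [mem_closedBall_zero_iff] at hz hw
  have h_factor : cap δ z - cap δ w = (‖z‖ + ‖w‖) / 2 * (‖w‖ - ‖z‖) := by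
    unfold cap
    ring
  rw [h_factor, abs_mul, abs_of_nonneg (by positivity), norm_sub_rev]
  gcongr
  · linarith
  · exact abs_norm_sub_norm_le w z

theorem concaveOn_cap [NormedSpace ℝ V] : ConcaveOn ℝ univ (cap δ : V → ℝ) := by
  have h_sq : ConvexOn ℝ univ fun z : V => ‖z‖ ^ 2 :=
    convexOn_univ_norm.pow (fun z _ => norm_nonneg z) 2
  refine (((concaveOn_const (δ ^ 2) convex_univ).sub h_sq).smul
    (by norm_num : (0 : ℝ) ≤ 2⁻¹)).congr fun z _ => ?_
  exact inv_mul_eq_div 2 (δ ^ 2 - ‖z‖ ^ 2)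

theorem cap_eq_sub_inner [InnerProductSpace ℝ V] (z w : V) :
    cap δ w = cap δ z - inner ℝ (w - z) z - ‖w - z‖ ^ 2 / 2 := by
  have h_norm := norm_add_sq_real (w - z) z
  rw [sub_add_cancel] at h_norm
  rw [cap, cap, h_norm]
  ring

end Cap

section Lens

variable {E : Type*} [NormedAddCommGroup E] [InnerProductSpace ℝ E]

/-- The height of `x` over the hyperplane through `p` orthogonal to `n`. -/
noncomputable def height (n p x : E) : ℝ := inner ℝ n (x - p)

/-- The projection of `x` to the hyperplane through `p` orthogonal to `n`, as a vector based at
`p`. -/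
noncomputable def base (n p x : E) : (ℝ ∙ n)ᗮ := (ℝ ∙ n)ᗮ.orthogonalProjectionOnto (x - p)

/-- The point over `z` at height `h`: the inverse of `x ↦ (base n p x, height n p x)`. -/
noncomputable def chart (n p : E) (z : (ℝ ∙ n)ᗮ) (h : ℝ) : E := p + z + h • n

/-- The parametrization of the graph of `η * cap δ` over the hyperplane through `p` orthogonal to
`n`. -/
noncomputable def graphMap (n p : E) (δ η : ℝ) (z : (ℝ ∙ n)ᗮ) : E := chart n p z (η * cap δ z)

/-- The convex body between the graphs of `-cap δ` and `η * cap δ`. -/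
def lens (n p : E) (δ η : ℝ) : Set E :=
  {x | height n p x ∈ Icc (-cap δ (base n p x)) (η * cap δ (base n p x))}

variable {n p x y : E} {δ η : ℝ} {z : (ℝ ∙ n)ᗮ} {h : ℝ}

@[fun_prop]
theorem continuous_height : Continuous (height n p) := by
  unfold height
  fun_prop

@[fun_prop]
theorem continuous_base : Continuous (base n p) := by
  unfold base
  fun_prop

theorem continuous_chart : Continuous fun q : (ℝ ∙ n)ᗮ × ℝ => chart n p q.1 q.2 := by
  unfold chart
  fun_prop

theorem continuous_graphMap : Continuous (graphMap n p δ η) :=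
  continuous_chart.comp (by fun_prop : Continuous fun z => (z, η * cap δ z))

theorem inner_orthogonal (z : (ℝ ∙ n)ᗮ) : inner ℝ n (z : E) = 0 :=
  Submodule.mem_orthogonal_singleton_iff_inner_right.1 z.2

theorem height_chart (hn : ‖n‖ = 1) : height n p (chart n p z h) = h := by
  rw [height, chart, add_assoc, add_sub_cancel_left, inner_add_right, inner_smul_right,
    real_inner_self_eq_norm_sq, hn, inner_orthogonal]
  ring

theorem base_chart : base n p (chart n p z h) = z := by
  rw [base, chart, add_assoc, add_sub_cancel_left, map_add, map_smul,
    Submodule.orthogonalProjectionOnto_mem_subspace_eq_self,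
    Submodule.orthogonalProjectionOnto_orthogonalComplement_singleton_eq_zero, smul_zero, add_zero]

theorem chart_base_height (hn : ‖n‖ = 1) (x : E) :
    chart n p (base n p x) (height n p x) = x := by
  have h_split := (ℝ ∙ n).starProjection_add_starProjection_orthogonal (x - p)
  rw [Submodule.starProjection_unit_singleton ℝ hn, Submodule.starProjection_apply] at h_split
  rw [chart, base, height, add_assoc, add_comm (Subtype.val _), h_split, add_sub_cancel]

theorem chart_add_smul (t : ℝ) : chart n p z h + t • n = chart n p z (h + t) := by
  rw [chart, chart, add_assoc, ← add_smul]

theorem height_add_smul (hn : ‖n‖ = 1) (t : ℝ) :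
    height n p (x + t • n) = height n p x + t := by
  rw [← chart_base_height hn x, chart_add_smul, height_chart hn, height_chart hn]

theorem base_add_smul (hn : ‖n‖ = 1) (t : ℝ) : base n p (x + t • n) = base n p x := by
  rw [← chart_base_height hn x, chart_add_smul, base_chart, base_chart]

theorem inner_sub_add_smul (z : (ℝ ∙ n)ᗮ) : inner ℝ (y - x) (n + η • (z : E)) =
    height n p y - height n p x + η * inner ℝ (base n p y - base n p x) z := by
  rw [height, height, base, base, ← inner_sub_right, ← map_sub, sub_sub_sub_cancel_right,
    Submodule.inner_orthogonalProjectionOnto_eq_of_mem_right, inner_add_right, inner_smul_right,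
    real_inner_comm n]

theorem norm_chart_sub_chart_sq (hn : ‖n‖ = 1) (z w : (ℝ ∙ n)ᗮ) (h k : ℝ) :
    ‖chart n p z h - chart n p w k‖ ^ 2 = ‖z - w‖ ^ 2 + (h - k) ^ 2 := by
  have h_diff : chart n p z h - chart n p w k = ((z - w : (ℝ ∙ n)ᗮ) : E) + (h - k) • n := by
    rw [chart, chart, sub_smul, Submodule.coe_sub]
    abel
  rw [h_diff, norm_add_sq_real, inner_smul_right, real_inner_comm, inner_orthogonal, norm_smul, hn,
    Real.norm_eq_abs, mul_one, sq_abs, Submodule.coe_norm]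
  ring

theorem lipschitzOnWith_graphMap (hn : ‖n‖ = 1) (hδ : 0 ≤ δ) :
    LipschitzOnWith (1 + (η * δ) ^ 2).toNNReal (graphMap n p δ η) (Metric.closedBall 0 δ) := by
  refine LipschitzOnWith.of_dist_le_mul fun z hz w hw => ?_
  rw [Real.coe_toNNReal _ (by positivity), dist_eq_norm, dist_eq_norm]
  refine le_of_sq_le_sq ?_ (by positivity)
  have h_cap : (η * cap δ z - η * cap δ w) ^ 2 ≤ (η * δ) ^ 2 * ‖z - w‖ ^ 2 := by
    rw [← mul_sub, mul_pow, mul_pow η, mul_assoc, ← mul_pow δ, ← sq_abs (cap δ z - cap δ w)]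
    gcongr
    exact abs_cap_sub_cap_le hδ hz hw
  rw [graphMap, graphMap, norm_chart_sub_chart_sq hn, mul_pow]
  nlinarith [mul_nonneg (sq_nonneg ((η * δ) ^ 2)) (sq_nonneg ‖z - w‖),
    mul_nonneg (sq_nonneg (η * δ)) (sq_nonneg ‖z - w‖)]

theorem mem_image_graphMap_iff (hn : ‖n‖ = 1) {s : Set (ℝ ∙ n)ᗮ} :
    x ∈ graphMap n p δ η '' s ↔ base n p x ∈ s ∧ height n p x = η * cap δ (base n p x) := by
  constructor
  · rintro ⟨z, hz, rfl⟩
    rw [graphMap, base_chart, height_chart hn]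
    exact ⟨hz, rfl⟩
  · rintro ⟨h_base, h_height⟩
    exact ⟨base n p x, h_base, by rw [graphMap, ← h_height, chart_base_height hn]⟩

theorem measurableEmbedding_graphMap [CompleteSpace E] [SecondCountableTopology E]
    [MeasurableSpace E] [BorelSpace E] : MeasurableEmbedding (graphMap n p δ η) :=
  continuous_graphMap.measurableEmbedding
    (Function.LeftInverse.injective (g := base n p) fun _ => base_chart)

theorem graphMap_eq_add (z : (ℝ ∙ n)ᗮ) : graphMap n p δ η z = p + graphMap n 0 δ η z := by
  rw [graphMap, graphMap, chart, chart, zero_add, add_assoc]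

theorem isClosed_lens : IsClosed (lens n p δ η) :=
  (isClosed_le (f := fun x => -cap δ (base n p x)) (by fun_prop) continuous_height).inter
    (isClosed_le continuous_height (by fun_prop))

theorem convex_lens (hη : 0 ≤ η) : Convex ℝ (lens n p δ η) := by
  have h_cap : ConcaveOn ℝ univ fun x => cap δ (base n p x) := by
    simpa [Function.comp_def, base, sub_eq_add_neg] using
      (concaveOn_cap (δ := δ)).comp_linearMap
        ((ℝ ∙ n)ᗮ.orthogonalProjectionOnto : E →ₗ[ℝ] (ℝ ∙ n)ᗮ) |>.translate_left (-p)
  have h_height : ConcaveOn ℝ univ (height n p) := by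
    unfold height
    simpa [Function.comp_def, sub_eq_add_neg] using
      ((innerₗ E n).concaveOn convex_univ).translate_left (-p)
  have h_height' : ConvexOn ℝ univ (height n p) := by
    unfold height
    simpa [Function.comp_def, sub_eq_add_neg] using
      ((innerₗ E n).convexOn convex_univ).translate_left (-p)
  have h_below := (h_height.add h_cap).convex_ge 0
  have h_above := (h_height'.sub (h_cap.smul hη)).convex_le 0
  convert h_below.inter h_above using 1
  ext x
  simp [lens, neg_le_iff_add_nonneg]

theorem cap_base_nonneg_of_mem_lens (hη : 0 ≤ η) (hx : x ∈ lens n p δ η) :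
    0 ≤ cap δ (base n p x) := by
  have h_le : -cap δ (base n p x) ≤ η * cap δ (base n p x) := hx.1.trans hx.2
  nlinarith

theorem lens_zero_subset (hη : 0 ≤ η) : lens n p δ 0 ⊆ lens n p δ η := fun x hx => by
  have h_cap := cap_base_nonneg_of_mem_lens le_rfl hx
  exact ⟨hx.1, hx.2.trans (by rw [zero_mul]; positivity)⟩

theorem isCompact_lens [FiniteDimensional ℝ E] (hn : ‖n‖ = 1) (hδ : 0 ≤ δ) (hη : 0 ≤ η) :
    IsCompact (lens n p δ η) := by
  have h_box : IsCompact
      (Metric.closedBall (0 : (ℝ ∙ n)ᗮ) δ ×ˢ Icc (-(δ ^ 2 / 2)) (η * (δ ^ 2 / 2))) :=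
    (isCompact_closedBall _ _).prod isCompact_Icc
  refine (h_box.image continuous_chart).of_isClosed_subset isClosed_lens fun x hx =>
    ⟨(base n p x, height n p x), ⟨?_, ?_, ?_⟩, chart_base_height hn x⟩
  · exact (cap_nonneg_iff hδ).1 (cap_base_nonneg_of_mem_lens hη hx)
  · exact (neg_le_neg (cap_le _)).trans hx.1
  · exact hx.2.trans (mul_le_mul_of_nonneg_left (cap_le _) hη)

theorem mem_interior_lens_iff (hn : ‖n‖ = 1) : x ∈ interior (lens n p δ η) ↔
    height n p x ∈ Ioo (-cap δ (base n p x)) (η * cap δ (base n p x)) := by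
  constructor
  · intro hx
    have h_line : ∀ᶠ t : ℝ in 𝓝 0, x + t • n ∈ lens n p δ η :=
      (by fun_prop : Continuous fun t : ℝ => x + t • n).tendsto' 0 x (by simp)
        (mem_interior_iff_mem_nhds.1 hx)
    obtain ⟨ε, hε, h_ball⟩ := Metric.eventually_nhds_iff_ball.1 h_line
    have h_up := (h_ball (ε / 2) (by simp [abs_of_pos hε, hε])).2
    have h_down := (h_ball (-(ε / 2)) (by simp [abs_of_pos hε, hε])).1
    rw [height_add_smul hn, base_add_smul hn] at h_up h_down
    exact ⟨by linarith, by linarith⟩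
  · intro hx
    refine mem_interior.2 ⟨{y | -cap δ (base n p y) < height n p y} ∩
      {y | height n p y < η * cap δ (base n p y)}, fun y hy => ⟨hy.1.le, hy.2.le⟩, ?_, hx⟩
    exact (isOpen_lt (by fun_prop) (by fun_prop)).inter (isOpen_lt (by fun_prop) (by fun_prop))

theorem interior_lens_nonempty (hn : ‖n‖ = 1) (hδ : 0 < δ) (hη : 0 ≤ η) :
    (interior (lens n p δ η)).Nonempty := by
  refine ⟨chart n p 0 (-(δ ^ 2 / 4)), (mem_interior_lens_iff hn).2 ?_⟩
  rw [height_chart hn, base_chart, cap, norm_zero]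
  have h_sq : 0 < δ ^ 2 := by positivity
  constructor <;> nlinarith

theorem frontier_lens (hn : ‖n‖ = 1) (hδ : 0 ≤ δ) (hη : 0 ≤ η) :
    frontier (lens n p δ η) =
      graphMap n p δ (-1) '' Metric.ball 0 δ ∪ graphMap n p δ η '' Metric.closedBall 0 δ := by
  ext x
  rw [isClosed_lens.frontier_eq, Set.mem_sdiff, mem_interior_lens_iff hn, mem_union,
    mem_image_graphMap_iff hn, mem_image_graphMap_iff hn, ← cap_pos_iff hδ, ← cap_nonneg_iff hδ,
    neg_one_mul]
  constructor
  · rintro ⟨hx, h_not⟩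
    have h_cap := cap_base_nonneg_of_mem_lens hη hx
    rcases hx.2.eq_or_lt with h_top | h_top
    · exact .inr ⟨h_cap, h_top⟩
    have h_bottom : height n p x = -cap δ (base n p x) :=
      (hx.1.eq_or_lt.resolve_right fun h_lt => h_not ⟨h_lt, h_top⟩).symm
    exact .inl ⟨h_cap.lt_of_ne fun h_zero => by simp [h_bottom, ← h_zero] at h_top, h_bottom⟩
  · rintro (⟨h_cap, h_eq⟩ | ⟨h_cap, h_eq⟩)
    · refine ⟨⟨h_eq.ge, ?_⟩, fun h_mem => h_mem.1.ne' h_eq⟩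
      nlinarith [mul_nonneg hη h_cap.le]
    · refine ⟨⟨?_, h_eq.le⟩, fun h_mem => h_mem.2.ne h_eq⟩
      nlinarith [mul_nonneg hη h_cap]

theorem inner_sub_graphMap_nonpos (hn : ‖n‖ = 1) (hη : 0 ≤ η) (hy : y ∈ lens n p δ η) :
    inner ℝ (y - graphMap n p δ η z) (n + η • (z : E)) ≤ 0 := by
  rw [inner_sub_add_smul (p := p), graphMap, height_chart hn, base_chart]
  have h_cap := mul_le_mul_of_nonneg_left (cap_eq_sub_inner (δ := δ) z (base n p y)).le hη
  nlinarith [hy.2, mul_nonneg hη (sq_nonneg ‖base n p y - z‖)]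

theorem exists_graphMap_add_smul_mem_lens (hn : ‖n‖ = 1) (hδ : 0 ≤ δ) (hη : 0 ≤ η)
    (hz : z ∈ Metric.ball 0 δ) {v : E} (hv : inner ℝ v (n + η • (z : E)) < 0) :
    ∃ t : ℝ, 0 < t ∧ graphMap n p δ η z + t • v ∈ lens n p δ η := by
  set x := graphMap n p δ η z
  have h_base_x : base n p x = z := base_chart
  have h_height_x : height n p x = η * cap δ z := height_chart hn
  have h_base (t : ℝ) : base n p (x + t • v) - z =
      t • (ℝ ∙ n)ᗮ.orthogonalProjectionOnto v := by
    rw [← h_base_x, base, base, ← map_sub, sub_sub_sub_cancel_right, add_sub_cancel_left, map_smul]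
  have h_line : Tendsto (fun t : ℝ => x + t • v) (𝓝[>] 0) (𝓝 x) :=
    ((by fun_prop : Continuous fun t : ℝ => x + t • v).tendsto' 0 x (by simp)).mono_left
      nhdsWithin_le_nhds
  have h_above_bottom : ∀ᶠ y in 𝓝 x, -cap δ (base n p y) < height n p y := by
    refine (isOpen_lt (by fun_prop) (by fun_prop)).mem_nhds ?_
    have h_cap := (cap_pos_iff hδ).2 hz
    rw [mem_ofPred_eq, h_base_x, h_height_x]
    nlinarith [mul_nonneg hη h_cap.le]
  have h_slope : ∀ᶠ t : ℝ in 𝓝[>] 0, inner ℝ v (n + η • (z : E)) +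
      η * t * ‖(ℝ ∙ n)ᗮ.orthogonalProjectionOnto v‖ ^ 2 / 2 < 0 := by
    refine nhdsWithin_le_nhds ((isOpen_lt (by fun_prop) continuous_const).mem_nhds ?_)
    simpa using hv
  obtain ⟨t, ⟨h_bottom, h_neg⟩, ht : 0 < t⟩ :=
    (((h_line.eventually h_above_bottom).and h_slope).and self_mem_nhdsWithin).exists
  refine ⟨t, ht, h_bottom.le, ?_⟩
  have h_top := inner_sub_add_smul (n := n) (p := p) (x := x) (y := x + t • v) (η := η) z
  rw [add_sub_cancel_left, inner_smul_left, h_base_x, h_height_x, conj_trivial] at h_top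
  have h_cap := cap_eq_sub_inner (δ := δ) z (base n p (x + t • v))
  have h_norm : ‖base n p (x + t • v) - z‖ ^ 2 =
      t ^ 2 * ‖(ℝ ∙ n)ᗮ.orthogonalProjectionOnto v‖ ^ 2 := by
    rw [h_base, norm_smul, mul_pow, Real.norm_eq_abs, sq_abs]
  rw [h_norm] at h_cap
  rw [h_cap]
  linarith [mul_neg_of_pos_of_neg ht h_neg]

theorem one_le_norm_add_smul (hn : ‖n‖ = 1) (z : (ℝ ∙ n)ᗮ) : 1 ≤ ‖n + η • (z : E)‖ := by
  have h_inner : inner ℝ n (n + η • (z : E)) = 1 := by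
    rw [inner_add_right, inner_smul_right, inner_orthogonal, real_inner_self_eq_norm_sq, hn]
    ring
  simpa [h_inner, hn] using real_inner_le_norm n (n + η • (z : E))

end Lens

section Normal

variable {N : ℕ} {A B : Set (EuclideanSpace ℝ (Fin N))} {x w ν : EuclideanSpace ℝ (Fin N)}

theorem innerUnitNormal_eq_of_unique (h : IsInnerUnitNormal A x ν)
    (h_unique : ∀ ν', IsInnerUnitNormal A x ν' → ν' = ν) : innerUnitNormal A x = ν := by
  have h_ex : ∃! ν, IsInnerUnitNormal A x ν := ⟨ν, h, h_unique⟩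
  rw [innerUnitNormal, dif_pos h_ex]
  exact h_unique _ h_ex.choose_spec.1

theorem norm_innerUnitNormal_le_one : ‖innerUnitNormal A x‖ ≤ 1 := by
  unfold innerUnitNormal
  split_ifs with h
  · exact h.choose_spec.1.1.le
  · simp

theorem innerUnitNormal_eq_of_tangent_halfSpace (hw : w ≠ 0)
    (h_support : ∀ y ∈ A, inner ℝ (y - x) w ≤ 0)
    (h_inward : ∀ v, inner ℝ v w < 0 → ∃ t : ℝ, 0 < t ∧ x + t • v ∈ A) :
    innerUnitNormal A x = -(‖w‖⁻¹ • w) := by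
  have hw_pos : 0 < ‖w‖ := norm_pos_iff.2 hw
  set e := -(‖w‖⁻¹ • w) with he
  have he_norm : ‖e‖ = 1 := by simp [he, norm_smul, hw_pos.ne']
  have hw_eq : w = -(‖w‖ • e) := by
    rw [he, smul_neg, neg_neg, smul_inv_smul₀ hw_pos.ne']
  have he_normal : IsInnerUnitNormal A x e := by
    refine ⟨he_norm, fun y hy => ?_⟩
    rw [he, inner_neg_right, inner_smul_right, neg_nonneg]
    exact mul_nonpos_of_nonneg_of_nonpos (inv_nonneg.2 hw_pos.le) (h_support y hy)
  refine innerUnitNormal_eq_of_unique he_normal fun ν hν => ?_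
  by_contra h_ne
  have h_lt : inner ℝ e ν < 1 :=
    (inner_lt_one_iff_real_of_norm_eq_one he_norm hν.1).2 (Ne.symm h_ne)
  have h_inner : inner ℝ (e - ν) w < 0 := by
    rw [hw_eq, inner_neg_right, inner_smul_right, inner_sub_left, real_inner_self_eq_norm_sq,
      he_norm, real_inner_comm]
    nlinarith
  obtain ⟨t, ht, htA⟩ := h_inward _ h_inner
  have h_nonneg := hν.2 _ htA
  rw [add_sub_cancel_left, inner_smul_left, inner_sub_left, real_inner_self_eq_norm_sq, hν.1,
    conj_trivial, mul_nonneg_iff_of_pos_left ht] at h_nonneg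
  linarith

theorem IsInnerUnitNormal.of_eventually (hB : Convex ℝ B) (hxB : x ∈ B)
    (hBA : ∀ᶠ y in 𝓝 x, y ∈ B → y ∈ A) (h : IsInnerUnitNormal A x ν) :
    IsInnerUnitNormal B x ν := by
  refine ⟨h.1, fun y hy => ?_⟩
  have h_segment : Tendsto (fun t : ℝ => x + t • (y - x)) (𝓝[>] 0) (𝓝 x) :=
    ((by fun_prop : Continuous fun t : ℝ => x + t • (y - x)).tendsto' 0 x (by simp)).mono_left
      nhdsWithin_le_nhds
  obtain ⟨t, h_mem, ht_pos, ht_le⟩ :=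
    ((h_segment.eventually hBA).and (Ioc_mem_nhdsGT one_pos)).exists
  have h_nonneg := h.2 _ (h_mem (hB.add_smul_sub_mem hxB hy ⟨ht_pos.le, ht_le⟩))
  rwa [add_sub_cancel_left, inner_smul_left, conj_trivial,
    mul_nonneg_iff_of_pos_left ht_pos] at h_nonneg

theorem innerUnitNormal_congr (hA : Convex ℝ A) (hB : Convex ℝ B) (hxA : x ∈ A) (hxB : x ∈ B)
    (hAB : ∀ᶠ y in 𝓝 x, y ∈ A ↔ y ∈ B) : innerUnitNormal A x = innerUnitNormal B x := by
  have h_eq : IsInnerUnitNormal A x = IsInnerUnitNormal B x := funext fun ν => propext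
    ⟨.of_eventually hB hxB (hAB.mono fun _ h => h.2),
      .of_eventually hA hxA (hAB.mono fun _ h => h.1)⟩
  unfold innerUnitNormal
  rw [h_eq]

end Normal

section Perimeter

theorem setLIntegral_image_le_of_lipschitzOnWith {X Y : Type*} [EMetricSpace X]
    [MeasurableSpace X] [BorelSpace X] [EMetricSpace Y] [MeasurableSpace Y] [BorelSpace Y]
    {K : ℝ≥0} {Γ : X → Y} {s : Set X} (hΓ : LipschitzOnWith K Γ s) (hΓ_meas : Measurable Γ)
    (d : ℕ) (F : Y → ℝ≥0∞) :
    ∫⁻ y in Γ '' s, F y ∂μHE[d] ≤ (K : ℝ≥0∞) ^ d * ∫⁻ x in s, F (Γ x) ∂μHE[d] := by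
  have h_le : (μHE[d] : Measure Y).restrict (Γ '' s) ≤
      ((K : ℝ≥0∞) ^ d) • Measure.map Γ ((μHE[d] : Measure X).restrict s) := by
    refine Measure.le_iff.2 fun T hT => ?_
    have h_image := (hΓ.mono (inter_subset_left (s := s) (t := Γ ⁻¹' T))).hausdorffMeasure_image_le
      (d := d) d.cast_nonneg
    rw [ENNReal.rpow_natCast] at h_image
    rw [Measure.restrict_apply hT, Measure.smul_apply, Measure.map_apply hΓ_meas hT,
      Measure.restrict_apply (hΓ_meas hT), inter_comm T, ← image_inter_preimage, inter_comm _ s]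
    simp only [Measure.euclideanHausdorffMeasure_def, Measure.smul_apply, ENNReal.smul_def,
      smul_eq_mul]
    rw [mul_left_comm]
    gcongr
  calc ∫⁻ y in Γ '' s, F y ∂μHE[d]
      ≤ ∫⁻ y, F y ∂(((K : ℝ≥0∞) ^ d) • Measure.map Γ ((μHE[d] : Measure X).restrict s)) :=
        lintegral_mono' h_le le_rfl
    _ = (K : ℝ≥0∞) ^ d * ∫⁻ y, F y ∂(Measure.map Γ ((μHE[d] : Measure X).restrict s)) := by
        rw [lintegral_smul_measure, smul_eq_mul]
    _ ≤ _ := by gcongr; exact lintegral_map_le F Γ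

theorem ball_ae_eq_closedBall {V : Type*} [NormedAddCommGroup V] [NormedSpace ℝ V]
    [FiniteDimensional ℝ V] [MeasurableSpace V] [BorelSpace V] (μ : Measure V)
    [μ.IsAddHaarMeasure] {r : ℝ} (hr : r ≠ 0) (x : V) :
    Metric.ball x r =ᵐ[μ] Metric.closedBall x r := by
  rw [← Metric.ball_union_sphere]
  exact (union_ae_eq_left_of_ae_eq_empty
    (ae_eq_empty.2 (Measure.addHaar_sphere_of_ne_zero μ x hr))).symm

variable {N : ℕ} {n p x : EuclideanSpace ℝ (Fin N)} {δ η : ℝ}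
  {g Φ : EuclideanSpace ℝ (Fin N) → ℝ≥0∞}

theorem euclideanHausdorffMeasure_orthogonal (hn : ‖n‖ = 1) :
    (μHE[N - 1] : Measure (ℝ ∙ n)ᗮ) = volume := by
  have hn_ne : n ≠ 0 := by
    rintro rfl
    simp at hn
  have h_finrank := (ℝ ∙ n).finrank_add_finrank_orthogonal
  rw [finrank_span_singleton hn_ne, finrank_euclideanSpace_fin] at h_finrank
  rw [show N - 1 = Module.finrank ℝ (ℝ ∙ n)ᗮ by omega]
  exact InnerProductSpace.euclideanHausdorffMeasure_eq_volume

theorem setLIntegral_image_graphMap_zero (hn : ‖n‖ = 1) (F : EuclideanSpace ℝ (Fin N) → ℝ≥0∞)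
    (s : Set (ℝ ∙ n)ᗮ) :
    ∫⁻ x in graphMap n p δ 0 '' s, F x ∂μHE[N - 1] = ∫⁻ z in s, F (graphMap n p δ 0 z) := by
  have h_iso : Isometry (graphMap n p δ 0) := by
    refine Isometry.of_dist_eq fun z w => ?_
    simp [graphMap, chart, dist_add_left, Subtype.dist_eq]
  have h_emb : MeasurableEmbedding (graphMap n p δ 0) := measurableEmbedding_graphMap
  have h_map : (μHE[N - 1] : Measure (EuclideanSpace ℝ (Fin N))).restrict
      (graphMap n p δ 0 '' s) = Measure.map (graphMap n p δ 0) (volume.restrict s) := by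
    rw [← euclideanHausdorffMeasure_orthogonal hn, ← h_iso.injective.preimage_image s,
      ← h_emb.restrict_map, h_iso.injective.preimage_image, h_iso.map_euclideanHausdorffMeasure,
      Measure.restrict_restrict_of_subset (image_subset_range _ _)]
  rw [h_map, h_emb.lintegral_map]

theorem setLIntegral_image_graphMap_le (hn : ‖n‖ = 1) (hδ : 0 ≤ δ)
    (F : EuclideanSpace ℝ (Fin N) → ℝ≥0∞) :
    ∫⁻ x in graphMap n p δ η '' Metric.closedBall 0 δ, F x ∂μHE[N - 1] ≤
      ENNReal.ofReal (1 + (η * δ) ^ 2) ^ (N - 1) *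
        ∫⁻ z in Metric.closedBall (0 : (ℝ ∙ n)ᗮ) δ, F (graphMap n p δ η z) := by
  have h_le := setLIntegral_image_le_of_lipschitzOnWith
    (lipschitzOnWith_graphMap (p := p) (η := η) hn hδ) continuous_graphMap.measurable (N - 1) F
  rwa [euclideanHausdorffMeasure_orthogonal hn] at h_le

theorem isConvexBody_lens (hn : ‖n‖ = 1) (hδ : 0 < δ) (hη : 0 ≤ η) :
    IsConvexBody (lens n p δ η) :=
  ⟨isCompact_lens hn hδ.le hη, convex_lens hη, interior_lens_nonempty hn hδ hη⟩

theorem innerUnitNormal_lens_graphMap (hn : ‖n‖ = 1) (hδ : 0 ≤ δ) (hη : 0 ≤ η) {z : (ℝ ∙ n)ᗮ}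
    (hz : z ∈ Metric.ball 0 δ) : innerUnitNormal (lens n p δ η) (graphMap n p δ η z) =
      -(‖n + η • (z : EuclideanSpace ℝ (Fin N))‖⁻¹ •
        (n + η • (z : EuclideanSpace ℝ (Fin N)))) :=
  innerUnitNormal_eq_of_tangent_halfSpace
    (norm_pos_iff.1 (one_pos.trans_le (one_le_norm_add_smul hn z)))
    (fun _ hy => inner_sub_graphMap_nonpos hn hη hy)
    (fun _ hv => exists_graphMap_add_smul_mem_lens hn hδ hη hz hv)

theorem innerUnitNormal_lens_eq_of_mem_bottom (hn : ‖n‖ = 1) (hδ : 0 ≤ δ) (hη : 0 ≤ η)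
    (hx : x ∈ graphMap n p δ (-1) '' Metric.ball 0 δ) :
    innerUnitNormal (lens n p δ η) x = innerUnitNormal (lens n p δ 0) x := by
  rw [mem_image_graphMap_iff hn, ← cap_pos_iff hδ, neg_one_mul] at hx
  obtain ⟨h_cap, h_height⟩ := hx
  have h_mem : x ∈ lens n p δ 0 := ⟨h_height.ge, by rw [h_height]; linarith⟩
  have h_below : ∀ᶠ y in 𝓝 x, height n p y < 0 :=
    (isOpen_lt continuous_height continuous_const).mem_nhds (by simpa [h_height])
  refine innerUnitNormal_congr (convex_lens hη) (convex_lens le_rfl) (lens_zero_subset hη h_mem)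
    h_mem ?_
  filter_upwards [h_below] with y hy
  exact ⟨fun h => ⟨h.1, by simpa using hy.le⟩, fun h => lens_zero_subset hη h⟩

/-- The part of the perimeter of a lens coming from the graph of `-cap δ`; by
`innerUnitNormal_lens_eq_of_mem_bottom` it is the same for all the lenses `lens n p δ η`. -/
noncomputable def bottomPerimeter (g Φ : EuclideanSpace ℝ (Fin N) → ℝ≥0∞)
    (n p : EuclideanSpace ℝ (Fin N)) (δ : ℝ) : ℝ≥0∞ :=
  ∫⁻ x in graphMap n p δ (-1) '' Metric.ball 0 δ,
    g x * Φ (innerUnitNormal (lens n p δ 0) x) ∂μHE[N - 1]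

/-- The anisotropic weighted area of the graph of `η * cap δ`, computed in the parameter domain:
`-(n + η • z)` is the inner normal of the lens, scaled by the area element. -/
noncomputable def graphArea (g Φ : EuclideanSpace ℝ (Fin N) → ℝ≥0∞)
    (n p : EuclideanSpace ℝ (Fin N)) (δ η : ℝ) : ℝ≥0∞ :=
  ∫⁻ z in Metric.closedBall (0 : (ℝ ∙ n)ᗮ) δ,
    g (graphMap n p δ η z) * Φ (-(n + η • (z : EuclideanSpace ℝ (Fin N))))

theorem bottomPerimeter_add_graphArea_zero_le (hn : ‖n‖ = 1) (hδ : 0 < δ) :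
    bottomPerimeter g Φ n p δ + graphArea g Φ n p δ 0 ≤
      anisotropicPerimeter (fun q => g q.1 * Φ q.2) (lens n p δ 0) := by
  set top := graphMap n p δ 0 '' Metric.ball 0 δ
  have h_subset : graphMap n p δ (-1) '' Metric.ball 0 δ ∪ top ⊆ frontier (lens n p δ 0) := by
    rw [frontier_lens hn hδ.le le_rfl]
    exact union_subset_union_right _ (image_mono Metric.ball_subset_closedBall)
  have h_disjoint : Disjoint (graphMap n p δ (-1) '' Metric.ball 0 δ) top := by
    refine Set.disjoint_left.2 fun x hx hx' => ?_
    rw [mem_image_graphMap_iff hn, ← cap_pos_iff hδ.le] at hx hx'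
    linarith [hx.1, hx.2, hx'.2]
  have h_top_meas : MeasurableSet top :=
    measurableEmbedding_graphMap.measurableSet_image.2 Metric.isOpen_ball.measurableSet
  have h_top : ∫⁻ x in top, g x * Φ (innerUnitNormal (lens n p δ 0) x) ∂μHE[N - 1] =
      graphArea g Φ n p δ 0 := by
    rw [setLIntegral_image_graphMap_zero hn, graphArea,
      ← setLIntegral_congr (ball_ae_eq_closedBall volume hδ.ne' 0)]
    refine setLIntegral_congr_fun Metric.isOpen_ball.measurableSet fun z hz => ?_
    simp only [innerUnitNormal_lens_graphMap hn hδ.le le_rfl hz, zero_smul, add_zero, hn, inv_one,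
      one_smul]
  rw [← h_top, bottomPerimeter, ← lintegral_union h_top_meas h_disjoint]
  exact lintegral_mono_set h_subset

theorem anisotropicPerimeter_lens_le (hn : ‖n‖ = 1) (hδ : 0 < δ) (hη : 0 ≤ η)
    (hΦ_hom : IsOneHomogeneous Φ) :
    anisotropicPerimeter (fun q => g q.1 * Φ q.2) (lens n p δ η) ≤ bottomPerimeter g Φ n p δ +
      ENNReal.ofReal (1 + (η * δ) ^ 2) ^ (N - 1) * graphArea g Φ n p δ η := by
  rw [anisotropicPerimeter, frontier_lens hn hδ.le hη]
  grw [lintegral_union_le]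
  have h_bottom_meas : MeasurableSet (graphMap n p δ (-1) '' Metric.ball 0 δ) :=
    measurableEmbedding_graphMap.measurableSet_image.2 Metric.isOpen_ball.measurableSet
  refine add_le_add (setLIntegral_congr_fun h_bottom_meas fun x hx => ?_).le
    ((setLIntegral_image_graphMap_le hn hδ.le _).trans ?_)
  · rw [innerUnitNormal_lens_eq_of_mem_bottom hn hδ.le hη hx]
  rw [graphArea, ← setLIntegral_congr (ball_ae_eq_closedBall volume hδ.ne' 0),
    ← setLIntegral_congr (ball_ae_eq_closedBall volume hδ.ne' 0)]
  gcongr _ * ?_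
  refine setLIntegral_mono' Metric.isOpen_ball.measurableSet fun z hz => ?_
  rw [innerUnitNormal_lens_graphMap hn hδ.le hη hz]
  set w := n + η • (z : EuclideanSpace ℝ (Fin N))
  have hw : 1 ≤ ‖w‖₊ := one_le_norm_add_smul hn z
  gcongr
  calc Φ (-(‖w‖⁻¹ • w)) = (‖w‖₊⁻¹ : ℝ≥0) * Φ (-w) := by
        rw [← smul_neg, ← hΦ_hom _ _ (inv_pos.2 (one_pos.trans_le hw)), NNReal.coe_inv, coe_nnnorm]
    _ ≤ Φ (-w) := mul_le_of_le_one_left' (ENNReal.coe_le_one_iff.2 (inv_le_one_of_one_le₀ hw))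

theorem bottomPerimeter_le (hn : ‖n‖ = 1) (hδ : 0 ≤ δ) {M : ℝ≥0∞} (hM : ∀ v, ‖v‖ ≤ 1 → Φ v ≤ M) :
    bottomPerimeter g Φ n p δ ≤ ENNReal.ofReal (1 + (-1 * δ) ^ 2) ^ (N - 1) *
      ∫⁻ z in Metric.closedBall (0 : (ℝ ∙ n)ᗮ) δ, g (graphMap n p δ (-1) z) * M := by
  refine le_trans ?_ (setLIntegral_image_graphMap_le hn hδ fun x => g x * M)
  refine (lintegral_mono fun x => ?_).trans
    (lintegral_mono_set (image_mono Metric.ball_subset_closedBall))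
  gcongr
  exact hM _ norm_innerUnitNormal_le_one

end Perimeter

section Translates

variable {E V : Type*} [MeasurableSpace E] [MeasurableSpace V] {μ : Measure E} [SFinite μ]
  {ν : Measure V} {g : E → ℝ≥0∞} {h : V → E}

open scoped Pointwise in
theorem ae_lintegral_add_ne_top [TopologicalSpace E] [T2Space E] [SecondCountableTopology E]
    [SigmaCompactSpace E] [BorelSpace E] [AddGroup E] [IsTopologicalAddGroup E]
    [μ.IsAddRightInvariant] [IsFiniteMeasure ν] (hg : Measurable g)
    (hg_loc : LocallyIntegrable g μ) (hh : Measurable h) {K : Set E} (hK : IsCompact K)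
    (hhK : ∀ᵐ z ∂ν, h z ∈ K) : ∀ᵐ p ∂μ, ∫⁻ z, g (p + h z) ∂ν ≠ ∞ := by
  rw [← Measure.restrict_univ (μ := μ), ← iUnion_compactCovering, ae_restrict_iUnion_iff]
  intro k
  have hL : IsCompact (compactCovering E k + K) := (isCompact_compactCovering E k).add hK
  have h_le (a : E) (ha : a ∈ K) :
      ∫⁻ p in compactCovering E k, g (p + a) ∂μ ≤ ∫⁻ x in compactCovering E k + K, g x ∂μ := by
    rw [← (measurePreserving_add_right μ a).setLIntegral_comp_preimage hL.measurableSet hg]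
    exact lintegral_mono_set fun p hp => add_mem_add hp ha
  have h_fin : ∫⁻ p in compactCovering E k, ∫⁻ z, g (p + h z) ∂ν ∂μ ≠ ∞ := by
    rw [lintegral_lintegral_swap (by fun_prop)]
    refine ne_top_of_le_ne_top ?_ (lintegral_mono_ae (hhK.mono fun z hz => h_le (h z) hz))
    rw [lintegral_const]
    exact ENNReal.mul_ne_top (hg_loc.integrableOn_isCompact hL).2.ne (measure_ne_top ν univ)
  filter_upwards [ae_lt_top (by fun_prop) h_fin] with p hp using hp.ne

theorem lintegral_mul_lintegral_add [AddGroup E] [MeasurableAdd₂ E] [MeasurableNeg E] [SFinite ν]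
    (hg : Measurable g) (hh : Measurable h) {φ : E → ℝ≥0∞} (hφ : Measurable φ) {k : V → ℝ≥0∞}
    (hk : Measurable k) (x : E) :
    ∫⁻ y, φ y * ∫⁻ z, g (-y + x + h z) * k z ∂ν ∂μ =
      ∫⁻ z, (φ ⋆ₗ[μ] g) (x + h z) * k z ∂ν := by
  calc ∫⁻ y, φ y * ∫⁻ z, g (-y + x + h z) * k z ∂ν ∂μ
      = ∫⁻ y, ∫⁻ z, φ y * (g (-y + x + h z) * k z) ∂ν ∂μ :=
        lintegral_congr fun y => (lintegral_const_mul _ (by fun_prop)).symm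
    _ = ∫⁻ z, ∫⁻ y, φ y * (g (-y + x + h z) * k z) ∂μ ∂ν :=
        lintegral_lintegral_swap (by fun_prop)
    _ = ∫⁻ z, (φ ⋆ₗ[μ] g) (x + h z) * k z ∂ν := by
        refine lintegral_congr fun z => ?_
        rw [lconvolution_def, ← lintegral_mul_const _ (by fun_prop)]
        simp only [mul_assoc, add_assoc]

end Translates

section Comparison

variable {N : ℕ} {n : EuclideanSpace ℝ (Fin N)} {δ η : ℝ}
  {g Φ φ : EuclideanSpace ℝ (Fin N) → ℝ≥0∞}

theorem graphArea_lconvolution (hg : Measurable g) (hΦ : Measurable Φ) (hφ : Measurable φ)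
    (x : EuclideanSpace ℝ (Fin N)) :
    graphArea (φ ⋆ₗ g) Φ n x δ η = ∫⁻ y, φ y * graphArea g Φ n (-y + x) δ η := by
  unfold graphArea
  simp_rw [graphMap_eq_add (p := x), graphMap_eq_add (p := -_ + x)]
  exact (lintegral_mul_lintegral_add hg continuous_graphMap.measurable hφ (by fun_prop) x).symm

theorem ae_bottomPerimeter_ne_top (hn : ‖n‖ = 1) (hδ : 0 ≤ δ) (hg : Measurable g)
    (hg_loc : LocallyIntegrable g) {M : ℝ≥0} (hM : ∀ v, ‖v‖ ≤ 1 → Φ v ≤ M) :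
    ∀ᵐ p, bottomPerimeter g Φ n p δ ≠ ∞ := by
  have hD := isCompact_closedBall (0 : (ℝ ∙ n)ᗮ) δ
  have : IsFiniteMeasure ((volume : Measure (ℝ ∙ n)ᗮ).restrict (Metric.closedBall 0 δ)) :=
    isFiniteMeasure_restrict.2 hD.measure_lt_top.ne
  have h_graph : Continuous (graphMap n 0 δ (-1)) := continuous_graphMap
  filter_upwards [ae_lintegral_add_ne_top (ν := volume.restrict _) hg hg_loc h_graph.measurable
    (hD.image h_graph)
    (ae_restrict_of_forall_mem hD.measurableSet fun z hz => mem_image_of_mem _ hz)] with p hp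
  refine ne_top_of_le_ne_top ?_ (bottomPerimeter_le hn hδ hM)
  rw [lintegral_mul_const' _ _ ENNReal.coe_ne_top]
  simp_rw [graphMap_eq_add (p := p)]
  finiteness

theorem ae_graphArea_zero_le (hn : ‖n‖ = 1) (hδ : 0 < δ) (hη : 0 ≤ η) (hg : Measurable g)
    (hg_loc : LocallyIntegrable g) (hΦ_hom : IsOneHomogeneous Φ) {M : ℝ≥0}
    (hM : ∀ v, ‖v‖ ≤ 1 → Φ v ≤ M)
    (hmono : MonotoneOnConvexBodies (anisotropicPerimeter fun q => g q.1 * Φ q.2)) :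
    ∀ᵐ p, graphArea g Φ n p δ 0 ≤
      ENNReal.ofReal (1 + (η * δ) ^ 2) ^ (N - 1) * graphArea g Φ n p δ η := by
  filter_upwards [ae_bottomPerimeter_ne_top hn hδ.le hg hg_loc hM] with p hp
  refine (ENNReal.add_le_add_iff_left hp).1 ?_
  calc bottomPerimeter g Φ n p δ + graphArea g Φ n p δ 0
      ≤ anisotropicPerimeter (fun q => g q.1 * Φ q.2) (lens n p δ 0) :=
        bottomPerimeter_add_graphArea_zero_le hn hδ
    _ ≤ anisotropicPerimeter (fun q => g q.1 * Φ q.2) (lens n p δ η) :=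
        hmono _ _ (isConvexBody_lens hn hδ le_rfl) (isConvexBody_lens hn hδ hη)
          (lens_zero_subset hη)
    _ ≤ _ := anisotropicPerimeter_lens_le hn hδ hη hΦ_hom

theorem graphArea_lconvolution_zero_le (hn : ‖n‖ = 1) (hδ : 0 < δ) (hη : 0 ≤ η)
    (hg : Measurable g) (hg_loc : LocallyIntegrable g) (hΦ : Measurable Φ)
    (hΦ_hom : IsOneHomogeneous Φ) {M : ℝ≥0} (hM : ∀ v, ‖v‖ ≤ 1 → Φ v ≤ M)
    (hmono : MonotoneOnConvexBodies (anisotropicPerimeter fun q => g q.1 * Φ q.2))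
    (hφ : Measurable φ) (x : EuclideanSpace ℝ (Fin N)) :
    graphArea (φ ⋆ₗ g) Φ n x δ 0 ≤
      ENNReal.ofReal (1 + (η * δ) ^ 2) ^ (N - 1) * graphArea (φ ⋆ₗ g) Φ n x δ η := by
  rw [graphArea_lconvolution hg hΦ hφ, graphArea_lconvolution hg hΦ hφ,
    ← lintegral_const_mul' _ _ (by finiteness)]
  simp_rw [mul_left_comm _ (φ _), neg_add_eq_sub]
  refine lintegral_mono_ae ?_
  filter_upwards [(quasiMeasurePreserving_sub_left volume x).ae
    (ae_graphArea_zero_le hn hδ hη hg hg_loc hΦ_hom hM hmono)] with y hy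
  gcongr

end Comparison

section Calculus

theorem hasDerivAt_setIntegral_of_locallyLipschitz {V : Type*} [MetricSpace V]
    [MeasurableSpace V] [OpensMeasurableSpace V] [SecondCountableTopology V] {μ : Measure V}
    [IsFiniteMeasureOnCompacts μ] {F : ℝ × V → ℝ} {F' : V → ℝ} {D : Set V} {t₀ : ℝ}
    (hF : LocallyLipschitz F) (hD : IsCompact D) (hF' : ContinuousOn F' D)
    (h_deriv : ∀ z ∈ D, HasDerivAt (fun t => F (t, z)) (F' z) t₀) :
    HasDerivAt (fun t => ∫ z in D, F (t, z) ∂μ) (∫ z in D, F' z ∂μ) t₀ := by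
  obtain ⟨K, hK⟩ := (hF.locallyLipschitzOn).exists_lipschitzOnWith_of_compact
    ((isCompact_closedBall t₀ 1).prod hD)
  have h_cont (t : ℝ) : ContinuousOn (fun z => F (t, z)) D :=
    (hF.continuous.comp (by fun_prop)).continuousOn
  refine (hasDerivAt_integral_of_dominated_loc_of_lip (bound := fun _ => K)
    (Metric.closedBall_mem_nhds t₀ one_pos)
    (.of_forall fun t => (h_cont t).aestronglyMeasurable hD.measurableSet)
    ((h_cont t₀).integrableOn_compact hD) (hF'.aestronglyMeasurable hD.measurableSet)
    (ae_restrict_of_forall_mem hD.measurableSet fun z hz => ?_)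
    (integrableOn_const hD.measure_ne_top)
    (ae_restrict_of_forall_mem hD.measurableSet h_deriv)).2
  refine LipschitzOnWith.of_dist_le_mul fun s hs t ht => ?_
  simpa [Prod.dist_eq] using hK.dist_le_mul (s, z) ⟨hs, hz⟩ (t, z) ⟨ht, hz⟩

theorem deriv_nonneg_of_forall_le {f : ℝ → ℝ} {f' a : ℝ} (hf : HasDerivAt f f' a)
    (h : ∀ x, a < x → f a ≤ f x) : 0 ≤ f' := by
  refine ge_of_tendsto hf.tendsto_slope_zero_right ?_
  filter_upwards [self_mem_nhdsWithin] with t (ht : 0 < t)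
  exact smul_nonneg (inv_nonneg.2 ht.le) (sub_nonneg.2 (h _ (by linarith)))

end Calculus

section CapIntegrals

variable {V : Type*} [NormedAddCommGroup V] {δ : ℝ}

theorem posPart_cap_of_notMem_ball (hδ : 0 ≤ δ) {z : V} (hz : z ∉ Metric.ball 0 δ) :
    (cap δ z)⁺ = 0 :=
  posPart_of_nonpos (not_lt.1 (mt (cap_pos_iff hδ).1 hz))

theorem lipschitzWith_posPart_cap (hδ : 0 ≤ δ) :
    LipschitzWith δ.toNNReal fun z : V => (cap δ z)⁺ := by
  have h_eq (z : V) : (cap δ z)⁺ = cap δ (min ‖z‖ δ) := by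
    rcases le_total ‖z‖ δ with hz | hz
    · rw [posPart_of_nonneg ((cap_nonneg_iff hδ).2 (mem_closedBall_zero_iff.2 hz)), min_eq_left hz,
        cap, cap, norm_norm]
    · rw [posPart_cap_of_notMem_ball hδ (mt mem_ball_zero_iff.1 hz.not_gt), min_eq_right hz, cap,
        Real.norm_of_nonneg hδ, sub_self, zero_div]
  have h_mem (z : V) : min ‖z‖ δ ∈ Metric.closedBall 0 δ :=
    mem_closedBall_zero_iff.2 (by rw [Real.norm_of_nonneg (by positivity)]; exact min_le_right _ _)
  refine LipschitzWith.of_dist_le_mul fun z w => ?_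
  rw [h_eq, h_eq, Real.coe_toNNReal δ hδ]
  refine (abs_cap_sub_cap_le hδ (h_mem z) (h_mem w)).trans (mul_le_mul_of_nonneg_left ?_ hδ)
  simpa [Real.dist_eq, dist_eq_norm] using (lipschitzWith_one_norm.min_const δ).dist_le_mul z w

theorem lineDeriv_posPart_cap_of_notMem_ball [NormedSpace ℝ V] (hδ : 0 ≤ δ) {z : V}
    (hz : z ∉ Metric.ball 0 δ) (w : V) : lineDeriv ℝ (fun z => (cap δ z)⁺) z w = 0 :=
  IsLocalMin.deriv_eq_zero <| .of_forall fun t => by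
    simpa only [zero_smul, add_zero, posPart_cap_of_notMem_ball hδ hz] using posPart_nonneg _

variable [InnerProductSpace ℝ V]

@[fun_prop]
theorem contDiff_cap {k : WithTop ℕ∞} : ContDiff ℝ k (cap δ : V → ℝ) :=
  (contDiff_const.sub (contDiff_norm_sq ℝ)).div_const 2

theorem hasFDerivAt_cap (z : V) : HasFDerivAt (cap δ) (-innerSL ℝ z) z := by
  have h := ((hasStrictFDerivAt_norm_sq z).hasFDerivAt.const_sub (δ ^ 2)).mul_const (2⁻¹ : ℝ)
  refine (h.congr_of_eventuallyEq (.of_forall fun w => div_eq_mul_inv _ _)).congr_fderiv ?_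
  ext w
  simp

theorem lineDeriv_posPart_cap_of_mem_ball (hδ : 0 ≤ δ) {z : V} (hz : z ∈ Metric.ball 0 δ) (w : V) :
    lineDeriv ℝ (fun z => (cap δ z)⁺) z w = -inner ℝ z w := by
  have h_eq : (fun z : V => (cap δ z)⁺) =ᶠ[𝓝 z] cap δ := by
    filter_upwards [Metric.isOpen_ball.mem_nhds hz] with y hy
    exact posPart_of_nonneg ((cap_pos_iff hδ).2 hy).le
  rw [h_eq.lineDeriv_eq, ((hasFDerivAt_cap z).hasLineDerivAt w).lineDeriv]
  rfl

variable [FiniteDimensional ℝ V] [MeasurableSpace V] [BorelSpace V] {μ : Measure V}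
  [μ.IsAddHaarMeasure]

theorem setIntegral_mul_inner_eq (hδ : 0 < δ) {H : V → ℝ} {C : ℝ≥0}
    (hH : LipschitzOnWith C H (Metric.closedBall 0 δ))
    (hH_diff : ∀ z ∈ Metric.ball 0 δ, DifferentiableAt ℝ H z) (w : V) :
    ∫ z in Metric.closedBall 0 δ, H z * inner ℝ z w ∂μ =
      ∫ z in Metric.closedBall 0 δ, fderiv ℝ H z w * cap δ z ∂μ := by
  obtain ⟨K, hK, hHK⟩ := hH.extend_real
  have h_ball := ball_ae_eq_closedBall μ hδ.ne' (0 : V)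
  have h_lineDeriv : ∀ z ∈ Metric.ball 0 δ, lineDeriv ℝ K z w = fderiv ℝ H z w := by
    intro z hz
    have h_eq : K =ᶠ[𝓝 z] H := by
      filter_upwards [Metric.isOpen_ball.mem_nhds hz] with y hy
      exact (hHK (Metric.ball_subset_closedBall hy)).symm
    rw [h_eq.lineDeriv_eq, (hH_diff z hz).lineDeriv_eq_fderiv]
  have h_compact : HasCompactSupport fun z : V => (cap δ z)⁺ :=
    .intro (isCompact_closedBall 0 δ) fun z hz =>
      posPart_cap_of_notMem_ball hδ.le (mt (Metric.ball_subset_closedBall ·) hz)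
  calc ∫ z in Metric.closedBall 0 δ, H z * inner ℝ z w ∂μ
      = ∫ z in Metric.ball 0 δ, lineDeriv ℝ (fun z => (cap δ z)⁺) z (-w) * K z ∂μ := by
        rw [← setIntegral_congr_set h_ball]
        refine setIntegral_congr_fun measurableSet_ball fun z hz => ?_
        rw [lineDeriv_posPart_cap_of_mem_ball hδ.le hz, inner_neg_right, neg_neg, mul_comm,
          hHK (Metric.ball_subset_closedBall hz)]
    _ = ∫ z, lineDeriv ℝ (fun z => (cap δ z)⁺) z (-w) * K z ∂μ :=
        setIntegral_eq_integral_of_forall_compl_eq_zero fun z hz => by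
          rw [lineDeriv_posPart_cap_of_notMem_ball hδ.le hz, zero_mul]
    _ = ∫ z, lineDeriv ℝ K z w * (cap δ z)⁺ ∂μ :=
        (hK.integral_lineDeriv_mul_eq (lipschitzWith_posPart_cap hδ.le) h_compact w).symm
    _ = ∫ z in Metric.ball 0 δ, lineDeriv ℝ K z w * (cap δ z)⁺ ∂μ :=
        (setIntegral_eq_integral_of_forall_compl_eq_zero fun z hz => by
          rw [posPart_cap_of_notMem_ball hδ.le hz, mul_zero]).symm
    _ = ∫ z in Metric.closedBall 0 δ, fderiv ℝ H z w * cap δ z ∂μ := by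
        rw [← setIntegral_congr_set h_ball]
        refine setIntegral_congr_fun measurableSet_ball fun z hz => ?_
        rw [h_lineDeriv z hz, posPart_of_nonneg ((cap_pos_iff hδ.le).2 hz).le]

theorem apply_zero_nonpos_of_setIntegral_mul_cap_nonpos {F : V → ℝ} (hF : Continuous F)
    (h : ∀ δ > 0, ∫ z in Metric.closedBall 0 δ, F z * cap δ z ∂μ ≤ 0) : F 0 ≤ 0 := by
  by_contra! hF0
  obtain ⟨δ, hδ, h_pos⟩ := Metric.eventually_nhds_iff_ball.1
    (continuous_const.continuousAt.eventually_lt hF.continuousAt hF0)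
  have h_pos' : ∀ z ∈ Metric.ball (0 : V) δ, 0 < F z * cap δ z := fun z hz =>
    mul_pos (h_pos z hz) ((cap_pos_iff hδ.le).2 hz)
  refine (h δ hδ).not_gt ?_
  rw [← setIntegral_congr_set (ball_ae_eq_closedBall μ hδ.ne' 0)]
  refine (setIntegral_pos_iff_support_of_nonneg_ae
    (ae_restrict_of_forall_mem measurableSet_ball fun z hz => (h_pos' z hz).le)
    (((hF.mul continuous_cap).continuousOn.integrableOn_compact
      (isCompact_closedBall 0 δ)).mono_set Metric.ball_subset_closedBall)).2 ?_
  have h_support : Metric.ball 0 δ ⊆ Function.support fun z => F z * cap δ z :=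
    fun z hz => (h_pos' z hz).ne'
  rw [inter_eq_right.2 h_support]
  exact Metric.measure_ball_pos μ 0 hδ

end CapIntegrals

section Variation

variable {E : Type*} [NormedAddCommGroup E] [InnerProductSpace ℝ E] {G Ψ : E → ℝ} {n p : E} {δ : ℝ}

theorem graphMap_zero (z : (ℝ ∙ n)ᗮ) : graphMap n p δ 0 z = p + z := by
  rw [graphMap, chart, zero_mul, zero_smul, add_zero]

@[fun_prop]
theorem contDiff_submodule_val (K : Submodule ℝ E) : ContDiff ℝ 1 (Subtype.val : K → E) :=
  K.subtypeL.contDiff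

theorem contDiff_uncurry_graphMap :
    ContDiff ℝ 1 fun q : ℝ × (ℝ ∙ n)ᗮ => graphMap n p δ q.1 q.2 := by
  unfold graphMap chart
  fun_prop

theorem locallyLipschitz_graphIntegrand (hG : ContDiff ℝ 1 G) (hΨ : LocallyLipschitz Ψ) :
    LocallyLipschitz fun q : ℝ × (ℝ ∙ n)ᗮ =>
      G (graphMap n p δ q.1 q.2) * Ψ (-(n + q.1 • (q.2 : E))) := by
  have h_normal : ContDiff ℝ 1 fun q : ℝ × (ℝ ∙ n)ᗮ => -(n + q.1 • (q.2 : E)) := by fun_prop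
  exact (contDiff_mul (𝕜 := ℝ) (n := 1)).locallyLipschitz.comp
    ((hG.comp contDiff_uncurry_graphMap).locallyLipschitz.prodMk
      (hΨ.comp h_normal.locallyLipschitz))

theorem hasDerivAt_graphIntegrand (hG : ContDiff ℝ 1 G) {L : E →L[ℝ] ℝ}
    (hL : HasFDerivAt Ψ L (-n)) (z : (ℝ ∙ n)ᗮ) :
    HasDerivAt (fun η : ℝ => G (graphMap n p δ η z) * Ψ (-(n + η • (z : E))))
      (Ψ (-n) * (fderiv ℝ G (p + z) n * cap δ z) - G (p + z) * L z) 0 := by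
  have h_graph : HasDerivAt (fun η : ℝ => graphMap n p δ η z) (cap δ z • n) 0 := by
    unfold graphMap chart
    simpa using ((hasDerivAt_id' (0 : ℝ)).mul_const (cap δ z)).smul_const n
  have h_normal : HasDerivAt (fun η : ℝ => -(n + η • (z : E))) (-z) 0 := by
    simpa using (((hasDerivAt_id' (0 : ℝ)).smul_const (z : E)).const_add n).fun_neg
  have hG' : HasFDerivAt G (fderiv ℝ G (p + z)) (graphMap n p δ 0 z) := by
    rw [graphMap_zero]
    exact (hG.differentiable one_ne_zero _).hasFDerivAt
  have hL' : HasFDerivAt Ψ L (-(n + (0 : ℝ) • (z : E))) := by rwa [zero_smul, add_zero]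
  refine ((hG'.comp_hasDerivAt 0 h_graph).mul (hL'.comp_hasDerivAt 0 h_normal)).congr_deriv ?_
  rw [Function.comp_apply, Function.comp_apply, graphMap_zero, zero_smul, add_zero, map_smul,
    map_neg, smul_eq_mul]
  ring

variable [FiniteDimensional ℝ E] [MeasurableSpace E] [BorelSpace E]

/-- The real-valued counterpart of `graphArea`: the anisotropic weighted area of the graph of
`η * cap δ`. -/
noncomputable def graphIntegral (G Ψ : E → ℝ) (n p : E) (δ η : ℝ) : ℝ :=
  ∫ z in Metric.closedBall (0 : (ℝ ∙ n)ᗮ) δ, G (graphMap n p δ η z) * Ψ (-(n + η • (z : E)))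

theorem hasDerivAt_graphIntegral (hG : ContDiff ℝ 1 G) (hΨ : LocallyLipschitz Ψ) {L : E →L[ℝ] ℝ}
    (hL : HasFDerivAt Ψ L (-n)) :
    HasDerivAt (graphIntegral G Ψ n p δ)
      (∫ z in Metric.closedBall (0 : (ℝ ∙ n)ᗮ) δ,
        (Ψ (-n) * (fderiv ℝ G (p + z) n * cap δ z) - G (p + z) * L z)) 0 := by
  have := hG.continuous
  have := hG.continuous_fderiv one_ne_zero
  exact hasDerivAt_setIntegral_of_locallyLipschitz
    (F := fun q : ℝ × (ℝ ∙ n)ᗮ => G (graphMap n p δ q.1 q.2) * Ψ (-(n + q.1 • (q.2 : E))))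
    (locallyLipschitz_graphIntegrand hG hΨ)
    (isCompact_closedBall 0 δ) (by fun_prop) fun z _ => hasDerivAt_graphIntegrand hG hL z

theorem setIntegral_mul_inner_orthogonal_eq (hδ : 0 < δ) (hG : ContDiff ℝ 1 G)
    (w : (ℝ ∙ n)ᗮ) :
    ∫ z in Metric.closedBall (0 : (ℝ ∙ n)ᗮ) δ, G (p + z) * inner ℝ z w =
      ∫ z in Metric.closedBall (0 : (ℝ ∙ n)ᗮ) δ, fderiv ℝ G (p + z) w * cap δ z := by
  have h_slice : ContDiff ℝ 1 fun z : (ℝ ∙ n)ᗮ => G (p + z) := by fun_prop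
  obtain ⟨C, hC⟩ := h_slice.locallyLipschitz.locallyLipschitzOn.exists_lipschitzOnWith_of_compact
    (isCompact_closedBall 0 δ)
  rw [setIntegral_mul_inner_eq hδ hC fun z _ => h_slice.differentiable one_ne_zero z]
  congr 1 with z
  have h_shift : HasFDerivAt (fun z : (ℝ ∙ n)ᗮ => p + (z : E)) (ℝ ∙ n)ᗮ.subtypeL z :=
    (ℝ ∙ n)ᗮ.subtypeL.hasFDerivAt.const_add p
  have h_chain := ((hG.differentiable one_ne_zero _).hasFDerivAt (x := p + (z : E))).comp z h_shift
  rw [HasFDerivAt.fderiv (f := fun z : (ℝ ∙ n)ᗮ => G (p + z)) h_chain]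
  rfl

theorem hasDerivAt_graphIntegral_of_isSublinear (hn : ‖n‖ = 1) (hδ : 0 < δ) (hG : ContDiff ℝ 1 G)
    (hΨ : IsSublinear Ψ) {l : E} (hl : HasGradientAt Ψ l (-n)) :
    HasDerivAt (graphIntegral G Ψ n p δ)
      (-∫ z in Metric.closedBall (0 : (ℝ ∙ n)ᗮ) δ, fderiv ℝ G (p + z) l * cap δ z) 0 := by
  obtain ⟨M, hM⟩ := hΨ.exists_le_mul_norm
  have h_deriv := hasDerivAt_graphIntegral (p := p) (δ := δ) hG
    (hΨ.lipschitzWith hM).locallyLipschitz hl.hasFDerivAt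
  have h_euler : height n 0 l = -Ψ (-n) := by
    rw [← hΨ.fderiv_apply_self hl.hasFDerivAt, InnerProductSpace.toDual_apply_apply,
      inner_neg_right, neg_neg, height, sub_zero, real_inner_comm]
  have h_split : l = base n 0 l - Ψ (-n) • n := by
    conv_lhs => rw [← chart_base_height (p := 0) hn l, chart, h_euler, zero_add, neg_smul,
      ← sub_eq_add_neg]
  have h_inner (z : (ℝ ∙ n)ᗮ) : inner ℝ l (z : E) = inner ℝ z (base n 0 l) := by
    rw [base, sub_zero, Submodule.inner_orthogonalProjectionOnto_eq_of_mem_left, real_inner_comm]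
  refine h_deriv.congr_deriv ?_
  have := hG.continuous
  have := hG.continuous_fderiv one_ne_zero
  simp_rw [InnerProductSpace.toDual_apply_apply, h_inner]
  have h_int {F : (ℝ ∙ n)ᗮ → ℝ} (hF : Continuous F) :
      IntegrableOn F (Metric.closedBall 0 δ) :=
    hF.continuousOn.integrableOn_compact (isCompact_closedBall 0 δ)
  rw [integral_sub (h_int (by fun_prop)) (h_int (by fun_prop)),
    setIntegral_mul_inner_orthogonal_eq hδ hG, ← integral_sub (h_int (by fun_prop))
    (h_int (by fun_prop)), ← integral_neg]
  congr 1 with z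
  conv_rhs => rw [h_split, map_sub, map_smul, smul_eq_mul]
  ring

theorem hasDerivAt_one_add_sq_pow (δ : ℝ) (d : ℕ) :
    HasDerivAt (fun η : ℝ => (1 + (η * δ) ^ 2) ^ d) 0 0 := by
  simpa using ((((hasDerivAt_id' (0 : ℝ)).mul_const δ).fun_pow 2).const_add 1).fun_pow d

theorem fderiv_apply_nonpos_of_graphIntegral_zero_le (hn : ‖n‖ = 1) (hG : ContDiff ℝ 1 G)
    (hΨ : IsSublinear Ψ) {l : E} (hl : HasGradientAt Ψ l (-n)) {d : ℕ}
    (h : ∀ δ > 0, ∀ η > 0,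
      graphIntegral G Ψ n p δ 0 ≤ (1 + (η * δ) ^ 2) ^ d * graphIntegral G Ψ n p δ η) :
    fderiv ℝ G p l ≤ 0 := by
  have := hG.continuous_fderiv one_ne_zero
  have h_nonpos := apply_zero_nonpos_of_setIntegral_mul_cap_nonpos (μ := volume)
    (F := fun z : (ℝ ∙ n)ᗮ => fderiv ℝ G (p + z) l) (by fun_prop) fun δ hδ => ?_
  · simpa using h_nonpos
  have h_deriv := (hasDerivAt_one_add_sq_pow δ d).mul
    (hasDerivAt_graphIntegral_of_isSublinear (p := p) hn hδ hG hΨ hl)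
  have h_slope := deriv_nonneg_of_forall_le h_deriv fun η hη => by simpa using h δ hδ η hη
  simpa using h_slope

theorem fderiv_eq_zero_of_graphIntegral_zero_le (hΨ : IsSublinear Ψ)
    (hΨ_pos : ∀ v, v ≠ 0 → 0 < Ψ v) (hG : ContDiff ℝ 1 G) {d : ℕ}
    (h : ∀ n : E, ‖n‖ = 1 → ∀ δ > 0, ∀ η > 0,
      graphIntegral G Ψ n p δ 0 ≤ (1 + (η * δ) ^ 2) ^ d * graphIntegral G Ψ n p δ η) :
    fderiv ℝ G p = 0 := by
  rw [← (InnerProductSpace.toDual ℝ E).symm.map_eq_zero_iff]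
  by_contra h_ne
  obtain ⟨m, L, hm, hL, hL_pos⟩ := hΨ.exists_hasFDerivAt_apply_pos (hΨ_pos _ h_ne)
  have h_grad : HasGradientAt Ψ ((InnerProductSpace.toDual ℝ E).symm L) (- -m) := by
    rw [neg_neg, hasGradientAt_iff_hasFDerivAt, LinearIsometryEquiv.apply_symm_apply]
    exact hL
  have h_nonpos := fderiv_apply_nonpos_of_graphIntegral_zero_le (by rwa [norm_neg]) hG hΨ h_grad
    (h (-m) (by rwa [norm_neg]))
  rw [← InnerProductSpace.toDual_symm_apply, real_inner_comm,
    InnerProductSpace.toDual_symm_apply] at h_nonpos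
  exact hL_pos.not_ge h_nonpos

end Variation

section Mollification

open scoped Convolution

variable {E : Type*} [NormedAddCommGroup E] [NormedSpace ℝ E] [FiniteDimensional ℝ E]
  [MeasurableSpace E] [BorelSpace E] {μ : Measure E} [μ.IsAddHaarMeasure]

theorem exists_ae_eq_const_of_convolution {γ : E → ℝ} (hγ : LocallyIntegrable γ μ)
    (h_const : ∀ φ : ContDiffBump (0 : E), ∀ x y,
      (φ.normed μ ⋆[ContinuousLinearMap.lsmul ℝ ℝ, μ] γ) x =
        (φ.normed μ ⋆[ContinuousLinearMap.lsmul ℝ ℝ, μ] γ) y) :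
    ∃ c, ∀ᵐ x ∂μ, γ x = c := by
  let φ (k : ℕ) : ContDiffBump (0 : E) :=
    { rIn := 1 / (k + 1)
      rOut := 2 * (1 / (k + 1))
      rIn_pos := by positivity
      rIn_lt_rOut := lt_two_mul_self (by positivity) }
  have h_rOut : Tendsto (fun k => (φ k).rOut) atTop (𝓝 0) := by
    simpa [φ] using tendsto_one_div_add_atTop_nhds_zero_nat.const_mul (2 : ℝ)
  have h_lim := ContDiffBump.ae_convolution_tendsto_right_of_locallyIntegrable
    (φ := φ) (K := 2) h_rOut (.of_forall fun _ => le_rfl) hγ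
  obtain ⟨x₀, hx₀⟩ := h_lim.exists
  refine ⟨γ x₀, ?_⟩
  filter_upwards [h_lim] with x hx
  exact tendsto_nhds_unique (hx.congr fun k => h_const (φ k) x x₀) hx₀

theorem lconvolution_ofReal_eq {φ : E → ℝ} {g : E → ℝ≥0∞} (hg : LocallyIntegrable g μ)
    (hφ : Continuous φ) (hφ_nonneg : ∀ x, 0 ≤ φ x) (hφ_supp : HasCompactSupport φ) (x : E) :
    ((fun y => ENNReal.ofReal (φ y)) ⋆ₗ[μ] g) x =
      ENNReal.ofReal ((φ ⋆[ContinuousLinearMap.lsmul ℝ ℝ, μ] fun x => (g x).toReal) x) := by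
  have h_int : Integrable (fun y => φ y • (g (x - y)).toReal) μ :=
    hφ_supp.convolutionExists_left (ContinuousLinearMap.lsmul ℝ ℝ) hφ
      (locallyIntegrable_toReal hg) x
  rw [lconvolution_def, convolution_lsmul, ofReal_integral_eq_lintegral_ofReal h_int
    (.of_forall fun y => mul_nonneg (hφ_nonneg y) ENNReal.toReal_nonneg)]
  refine lintegral_congr_ae ?_
  filter_upwards [(quasiMeasurePreserving_sub_left μ x).ae (ae_ne_top_of_locallyIntegrable hg)]
    with y hy
  rw [smul_eq_mul, ENNReal.ofReal_mul (hφ_nonneg y), ENNReal.ofReal_toReal hy, neg_add_eq_sub]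

end Mollification

section Rigidity

open scoped Convolution

variable {N : ℕ} {g Φ : EuclideanSpace ℝ (Fin N) → ℝ≥0∞}

theorem graphArea_ofReal {G : EuclideanSpace ℝ (Fin N) → ℝ} (hG : Continuous G)
    (hG_nonneg : ∀ x, 0 ≤ G x) (hΦ_fin : ∀ v, Φ v ≠ ∞) (hΦ : Continuous fun v => (Φ v).toReal)
    (n p : EuclideanSpace ℝ (Fin N)) (δ η : ℝ) :
    graphArea (fun x => ENNReal.ofReal (G x)) Φ n p δ η =
      ENNReal.ofReal (graphIntegral G (fun v => (Φ v).toReal) n p δ η) := by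
  have h_cont : Continuous fun z : (ℝ ∙ n)ᗮ => G (graphMap n p δ η z) *
      (Φ (-(n + η • (z : EuclideanSpace ℝ (Fin N))))).toReal :=
    (hG.comp continuous_graphMap).mul (hΦ.comp (by fun_prop))
  rw [graphArea, graphIntegral, ofReal_integral_eq_lintegral_ofReal
    (h_cont.continuousOn.integrableOn_compact (isCompact_closedBall 0 δ))
    (.of_forall fun z => mul_nonneg (hG_nonneg _) ENNReal.toReal_nonneg)]
  refine lintegral_congr fun z => ?_
  rw [ENNReal.ofReal_mul (hG_nonneg _), ENNReal.ofReal_toReal (hΦ_fin _)]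

theorem fderiv_convolution_eq_zero (hg : Measurable g) (hg_loc : LocallyIntegrable g)
    (hΦ_hom : IsOneHomogeneous Φ) (hΦ_convex : ConvexOn ℝ≥0 univ Φ) (hΦ_fin : ∀ v, Φ v ≠ ∞)
    (hΦ_pos : ∀ v, v ≠ 0 → 0 < Φ v)
    (hmono : MonotoneOnConvexBodies (anisotropicPerimeter fun q => g q.1 * Φ q.2))
    {φ : EuclideanSpace ℝ (Fin N) → ℝ} (hφ : ContDiff ℝ 1 φ) (hφ_nonneg : ∀ x, 0 ≤ φ x)
    (hφ_supp : HasCompactSupport φ) (p : EuclideanSpace ℝ (Fin N)) :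
    fderiv ℝ (φ ⋆[ContinuousLinearMap.lsmul ℝ ℝ, volume] fun x => (g x).toReal) p = 0 := by
  set G := φ ⋆[ContinuousLinearMap.lsmul ℝ ℝ, volume] fun x => (g x).toReal with hG_def
  have hG : ContDiff ℝ 1 G :=
    hφ_supp.contDiff_convolution_left _ hφ (locallyIntegrable_toReal hg_loc)
  have hG_nonneg (x) : 0 ≤ G x :=
    integral_nonneg fun y => mul_nonneg (hφ_nonneg y) ENNReal.toReal_nonneg
  have hΨ := isSublinear_toReal hΦ_hom hΦ_convex hΦ_fin
  have hΦ_meas : Measurable Φ := by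
    simpa only [ENNReal.ofReal_toReal (hΦ_fin _)] using hΨ.continuous.measurable.ennreal_ofReal
  obtain ⟨M, hM⟩ := hΨ.exists_le_mul_norm
  have hΦ_le (v) (hv : ‖v‖ ≤ 1) : Φ v ≤ M := by
    rw [← ENNReal.ofReal_toReal (hΦ_fin v), ← ENNReal.ofReal_coe_nnreal]
    exact ENNReal.ofReal_le_ofReal ((hM v).trans (mul_le_of_le_one_right M.2 hv))
  refine fderiv_eq_zero_of_graphIntegral_zero_le hΨ
    (fun v hv => ENNReal.toReal_pos (hΦ_pos v hv).ne' (hΦ_fin v)) hG (d := N - 1)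
    fun n hn δ hδ η hη => ?_
  have h_area := graphArea_lconvolution_zero_le (φ := fun y => ENNReal.ofReal (φ y)) hn hδ hη.le hg
    hg_loc hΦ_meas hΦ_hom hΦ_le hmono
    hφ.continuous.measurable.ennreal_ofReal p
  rw [funext (lconvolution_ofReal_eq hg_loc hφ.continuous hφ_nonneg hφ_supp), ← hG_def,
    graphArea_ofReal hG.continuous hG_nonneg hΦ_fin hΨ.continuous,
    graphArea_ofReal hG.continuous hG_nonneg hΦ_fin hΨ.continuous,
    ← ENNReal.ofReal_pow (by positivity), ← ENNReal.ofReal_mul (by positivity)] at h_area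
  refine (ENNReal.ofReal_le_ofReal_iff (mul_nonneg (by positivity) ?_)).1 h_area
  exact integral_nonneg fun z => mul_nonneg (hG_nonneg _) ENNReal.toReal_nonneg

end Rigidity

end WeightedPerimeter

open WeightedPerimeter in
theorem corollary1p2_general {N : ℕ} (hN : 0 < N)
    {f : EuclideanSpace ℝ (Fin N) × EuclideanSpace ℝ (Fin N) → ℝ≥0∞}
    (hf_loc : LocallyIntegrable f volume) {g : EuclideanSpace ℝ (Fin N) → ℝ≥0∞}
    (hg : Measurable g) {Φ : EuclideanSpace ℝ (Fin N) → ℝ≥0∞} (hΦ_hom : IsOneHomogeneous Φ)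
    (hΦ_convex : ConvexOn ℝ≥0 univ Φ) (hΦ_pos : ∀ v, v ≠ 0 → 0 < Φ v)
    (hfac : ∀ x v, f (x, v) = g x * Φ v)
    (hmono : MonotoneOnConvexBodies (anisotropicPerimeter f)) :
    ∃ c : ℝ≥0, ∀ᵐ x ∂(volume : Measure (EuclideanSpace ℝ (Fin N))), g x = c := by
  obtain rfl : f = fun q => g q.1 * Φ q.2 := funext fun q => hfac q.1 q.2
  by_cases hg_zero : g =ᵐ[volume] 0
  · exact ⟨0, hg_zero⟩
  have : Nonempty (Fin N) := ⟨⟨0, hN⟩⟩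
  have hΦ_ne_zero : ∀ᵐ v ∂(volume : Measure (EuclideanSpace ℝ (Fin N))), Φ v ≠ 0 := by
    filter_upwards [Measure.ae_ne volume 0] with v hv using (hΦ_pos v hv).ne'
  have hg_loc : LocallyIntegrable g volume :=
    locallyIntegrable_left_of_locallyIntegrable_mul hg.aemeasurable hΦ_ne_zero hf_loc
  have hΦ_fin : ∀ v, Φ v ≠ ∞ := ne_top_of_convexOn_of_ae_ne_top hΦ_convex
    (ae_ne_top_right_of_locallyIntegrable_mul hf_loc hg_zero)
  obtain ⟨c, hc⟩ := exists_ae_eq_const_of_convolution (locallyIntegrable_toReal hg_loc)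
    fun φ x y => is_const_of_fderiv_eq_zero (𝕜 := ℝ)
      ((φ.hasCompactSupport_normed.contDiff_convolution_left _ φ.contDiff_normed
        (locallyIntegrable_toReal hg_loc)).differentiable one_ne_zero)
      (fderiv_convolution_eq_zero hg hg_loc hΦ_hom hΦ_convex hΦ_fin hΦ_pos hmono φ.contDiff_normed
        φ.nonneg_normed φ.hasCompactSupport_normed) x y
  refine ⟨c.toNNReal, ?_⟩
  filter_upwards [hc, ae_ne_top_of_locallyIntegrable hg_loc] with x hx hx_fin
  rw [← ENNReal.ofReal_toReal hx_fin, hx]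
  rfl

theorem corollary1p2 (N : ℕ) (hN : 2 ≤ N)
    (f : EuclideanSpace ℝ (Fin N) × EuclideanSpace ℝ (Fin N) → ℝ≥0∞)
    (hf : Measurable f) (hf_loc : LocallyIntegrable f volume)
    (g : EuclideanSpace ℝ (Fin N) → ℝ≥0∞)
    (hg : Measurable g) (hg_radial : WeightedPerimeter.IsRadial g)
    (Φ : EuclideanSpace ℝ (Fin N) → ℝ≥0∞)
    (hΦ_lsc : LowerSemicontinuous Φ)
    (hΦ_hom : WeightedPerimeter.IsOneHomogeneous Φ)
    (hΦ_convex : ConvexOn ℝ≥0 univ Φ)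
    (hΦ_pos : ∀ v, v ≠ 0 → 0 < Φ v)
    (hfac : ∀ x v, f (x, v) = g x * Φ v)
    (hmono : WeightedPerimeter.MonotoneOnConvexBodies
      (WeightedPerimeter.anisotropicPerimeter f)) :
    ∃ c : ℝ≥0, ∀ᵐ x ∂(volume : Measure (EuclideanSpace ℝ (Fin N))), g x = c :=
  corollary1p2_general (by omega) hf_loc hg hΦ_hom hΦ_convex hΦ_pos hfac hmono
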